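/- Let $n\ge 1$ and let $a,b,c$ be real numbers with $c\neq 0$. Consider the Brusselator system $$v_t=\Delta v+v^2w-(b+1)v+a,\qquad w_t=c\,\Delta w-v^2w+bv,\qquad \Delta=\sum_{i=1}^n\frac{\partial^2}{\partial x_i^2}.$$ Write $u^1=v$, $u^2=w$, and let $\mathcal F$ be the algebra of smooth functions of $t,x_1,\dots,x_n$ and the space derivatives $u^k_I=\partial^{|I|}u^k/\partial x^I$ ($k=1,2$, $I\in\mathbb Z_{\ge0}^n$), each function depending on finitely many of these variables. Let $F^1,F^2\in\mathcal F$ be the right-hand sides of the system and let $$D_{x_i}=\frac{\partial}{\partial x_i}+\sum_{k,I}u^k_{I+1_i}\frac{\partial}{\partial u^k_I},\qquad D_t=\frac{\partial}{\partial t}+\sum_{k,I}D_x^I(F^k)\frac{\partial}{\partial u^k_I}$$ be the total derivatives on the system. A conserved current is a tuple $J=(J_0,\dots,J_n)$ of elements of $\mathcal F$ with $D_tJ_0+\sum_iD_{x_i}J_i=0$; with $D_0=D_t$ and $D_i=D_{x_i}$, it is trivial if $J_k=\sum_{l<k}D_l(L_{lk})-\sum_{k<l}D_l(L_{kl})$ for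 some $L_{kl}\in\mathcal F$ ($0\le k<l\le n$). Two currents are equivalent if they differ by a trivial one, and conservation laws are the equivalence classes of conserved currents. The characteristic of $J$ is $\chi=(\chi_1,\chi_2)$, where $\chi_k=\sum_I(-1)^{|I|}D_x^I\bigl(\partial J_0/\partial u^k_I\bigr)$. (1) Let $c\ne1$. For each smooth function $G(x_1,\dots,x_n)$ with $G+(c-1)\Delta G=0$ and any smooth antiderivatives $\int G\,dx_i$ of $G$ in the variables $x_i$ (these exist), the tuple $$J_0=G\,e^{\frac{ct}{c-1}}(v+w),\qquad J_i=e^{\frac{ct}{c-1}}\Bigl(\frac{\partial G}{\partial x_i}(v+cw)-G\,(v_{x_i}+c\,w_{x_i})-\frac an\int G\,dx_i\Bigr),\quad i=1,\dots,n,$$ is a conserved current with characteristic $\chi_1=\chi_2=G\,e^{\frac{ct}{c-1}}$. These currents span the space of conservation laws: for each conserved current $J$ there is a smooth $G$ with $G+(c-1)\Delta G=0$ such that the characteristic of $J$ is $\chi_1=\chi_2=G\,e^{\frac{ct}{c-1}}$ and $J$ is equivalent to the conserved current above built from $G$, for any choice of the antiderivatives. (2) If $c=1$, there are no nontrivial conservation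 laws: every conserved current is trivial. -/

import Mathlib

open scoped ContDiff

noncomputable section

namespace Brusselator

/-- Coordinates on the infinitely prolonged equation of a first order evolution system
`∂u^k/∂t = F^k` with `n` space variables and `m` unknown functions: the time `t`, the space
variables `x i`, and the space derivatives `u k I = ∂^{|I|} u^k / ∂x^I`, for `I` a multi-index. All
`t`-derivatives are expressed through these by means of the system. -/
inductive Coord (n m : ℕ) : Type
  | t : Coord n m
  | x (i : Fin n) : Coord n m
  | u (k : Fin m) (I : Fin n → ℕ) : Coord n m
  deriving DecidableEq

/-- Real functions of all the coordinates. -/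
abbrev Fun (n m : ℕ) : Type := (Coord n m → ℝ) → ℝ

/-- Membership in the algebra of differential functions: smooth functions that depend only on
finitely many of the coordinates. -/
def IsDiffFun {n m : ℕ} (f : Fun n m) : Prop :=
  ∃ (S : Finset (Coord n m)) (g : (S → ℝ) → ℝ),
    ContDiff ℝ ∞ g ∧ ∀ p : Coord n m → ℝ, f p = g (fun z => p z)

/-- The partial derivative with respect to the coordinate `z`. -/
def pd {ι : Type} [DecidableEq ι] (z : ι) (f : (ι → ℝ) → ℝ) : (ι → ℝ) → ℝ :=
  fun p => deriv (fun s => f (Function.update p z s)) (p z)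

/-- The total derivative with respect to `x i`:
`∂/∂x_i + ∑_{k,I} u^k_{I+1_i} ∂/∂u^k_I`. The sum has finitely many nonzero terms on differential
functions. -/
def Dx {n m : ℕ} (i : Fin n) (f : Fun n m) : Fun n m :=
  fun p => pd (.x i) f p +
    ∑ᶠ kI : Fin m × (Fin n → ℕ), p (.u kI.1 (kI.2 + Pi.single i 1)) * pd (.u kI.1 kI.2) f p

/-- The iterated total derivative `D_x^I = D_{x_1}^{I_1} ⋯ D_{x_n}^{I_n}`. -/
def DxI {n m : ℕ} (I : Fin n → ℕ) (f : Fun n m) : Fun n m :=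
  (List.finRange n).foldr (fun i h => (Dx i)^[I i] h) f

/-- The total derivative with respect to `t` on the equation `∂u^k/∂t = F^k`:
`∂/∂t + ∑_{k,I} D_x^I(F^k) ∂/∂u^k_I`. -/
def Dt {n m : ℕ} (F : Fin m → Fun n m) (f : Fun n m) : Fun n m :=
  fun p => pd .t f p +
    ∑ᶠ kI : Fin m × (Fin n → ℕ), DxI kI.2 (F kI.1) p * pd (.u kI.1 kI.2) f p

/-- The total derivatives `D_0 = D_t` and `D_{i+1} = D_{x_i}`. -/
def D {n m : ℕ} (F : Fin m → Fun n m) (k : Fin (n + 1)) : Fun n m → Fun n m :=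
  Fin.cases (Dt F) (fun i => Dx i) k

/-- `J = (J_0, J_1, …, J_n)` is a conserved current: `D_t J_0 + ∑_i D_{x_i} J_i = 0`. -/
def IsConservedCurrent {n m : ℕ} (F : Fin m → Fun n m) (J : Fin (n + 1) → Fun n m) : Prop :=
  (∀ k, IsDiffFun (J k)) ∧ ∀ p, ∑ k, D F k (J k) p = 0

/-- `J` is trivial: `J_k = ∑_{l<k} D_l(L_{lk}) - ∑_{k<l} D_l(L_{kl})` for some differential
functions `L_{kl}`, `k < l`. -/
def IsTrivialCurrent {n m : ℕ} (F : Fin m → Fun n m) (J : Fin (n + 1) → Fun n m) : Prop :=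
  ∃ L : Fin (n + 1) → Fin (n + 1) → Fun n m,
    (∀ k l, k < l → IsDiffFun (L k l)) ∧
    ∀ k p, J k p = ∑ l ∈ Finset.Iio k, D F l (L l k) p - ∑ l ∈ Finset.Ioi k, D F l (L k l) p

/-- Two currents are equivalent if they differ by a trivial one. Conservation laws are the
equivalence classes of conserved currents. -/
def CurrentEquiv {n m : ℕ} (F : Fin m → Fun n m) (J J' : Fin (n + 1) → Fun n m) : Prop :=
  IsTrivialCurrent F (J - J')

/-- The characteristic `χ_k = ∑_I (-1)^{|I|} D_x^I(∂J_0/∂u^k_I)` of a conserved current. -/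
def characteristic {n m : ℕ} (J : Fin (n + 1) → Fun n m) (k : Fin m) : Fun n m :=
  fun p => ∑ᶠ I : Fin n → ℕ, (-1 : ℝ) ^ (∑ i, I i) * DxI I (pd (.u k I) (J 0)) p

/-- The right-hand side of the Brusselator system; `u 0 = v` and `u 1 = w`:
`v_t = Δv + v²w - (b+1)v + a`, `w_t = cΔw - v²w + bv`. -/
def rhs (n : ℕ) (a b c : ℝ) : Fin 2 → Fun n 2 :=
  ![fun p => ∑ i, p (.u 0 (Pi.single i 2)) + p (.u 0 0) ^ 2 * p (.u 1 0)
      - (b + 1) * p (.u 0 0) + a,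
    fun p => c * ∑ i, p (.u 1 (Pi.single i 2)) - p (.u 0 0) ^ 2 * p (.u 1 0)
      + b * p (.u 0 0)]

/-- The space variables of a point. -/
def space {n m : ℕ} (p : Coord n m → ℝ) : Fin n → ℝ := fun i => p (.x i)

/-- `G` is a smooth function of the space variables with `G + (c-1) ΔG = 0`. -/
def IsProfile {n : ℕ} (c : ℝ) (G : (Fin n → ℝ) → ℝ) : Prop :=
  ContDiff ℝ ∞ G ∧ ∀ x, G x + (c - 1) * ∑ i, pd i (pd i G) x = 0

/-- `H i` is a smooth antiderivative `∫ G dx_i` of `G` in the variable `x_i`, for each `i`. -/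
def IsAntiderivatives {n : ℕ} (G : (Fin n → ℝ) → ℝ) (H : Fin n → (Fin n → ℝ) → ℝ) : Prop :=
  ∀ i, ContDiff ℝ ∞ (H i) ∧ ∀ x, pd i (H i) x = G x

/-- The current with components `J_0 = G e^{ct/(c-1)} (v + w)` and
`J_i = e^{ct/(c-1)} (G_{x_i} (v + c w) - G (v_{x_i} + c w_{x_i}) - (a/n) ∫ G dx_i)`. -/
def current {n : ℕ} (a c : ℝ) (G : (Fin n → ℝ) → ℝ) (H : Fin n → (Fin n → ℝ) → ℝ) :
    Fin (n + 1) → Fun n 2 :=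
  Fin.cases
    (fun p => G (space p) * Real.exp (c * p .t / (c - 1)) * (p (.u 0 0) + p (.u 1 0)))
    (fun i p => Real.exp (c * p .t / (c - 1)) *
      (pd i G (space p) * (p (.u 0 0) + c * p (.u 1 0))
        - G (space p) * (p (.u 0 (Pi.single i 1)) + c * p (.u 1 (Pi.single i 1)))
        - a / n * H i (space p)))

end Brusselator

end

/-!
The Euler operators `∑_I (-D_x)^I ∘ ∂/∂u^k_I` annihilate the total `x`-divergences, so applying them
to `D_t J_0 + ∑_i D_{x_i} J_i = 0` shows that the characteristic `χ` solves the adjoint of the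
linearized system. Comparing the derivatives of highest order in this equation lowers the order of
`χ` until `χ` depends on `t` and `x` only; the one resonant case is `c = -1`, where the reaction
terms have to be used. The second adjoint equation is then `χ_{2,t} + c Δχ_2 + v² (χ_1 - χ_2) = 0`,
so `χ_1 = χ_2 = χ`, and what remains is `χ_t + Δχ = χ` and `χ_t + c Δχ = 0`. For `c ≠ 1` these say
`χ = G e^{ct/(c-1)}` with `G + (c-1) ΔG = 0`, and for `c = 1` they say `χ = 0`.

Conversely, a current with zero characteristic is trivial. Scaling all `u^k_I` to zero writes `J_0`
as an integral of `∑_{k,I} u^k_I ∂J_0/∂u^k_I`, integration by parts turns this into a total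
`x`-divergence, and after subtracting a trivial current `J_0 = 0`. The remaining divergence-free
tuple `(J_1, …, J_n)` is reduced in the same way, one space direction after the other, with
integration by parts in the directions already treated only.
-/

noncomputable section

namespace Brusselator

variable {n m : ℕ}

section ParametricIntegral

universe v

variable {E F : Type v} [NormedAddCommGroup E] [NormedSpace ℝ E] [FiniteDimensional ℝ E]
  [NormedAddCommGroup F] [NormedSpace ℝ F] {f : E × ℝ → F}

theorem hasFDerivAt_integral_of_contDiff (hf : ContDiff ℝ ∞ f) (x : E) :
    HasFDerivAt (fun x => ∫ s in (0:ℝ)..1, f (x, s))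
      (∫ s in (0:ℝ)..1, (fderiv ℝ f (x, s)).comp (ContinuousLinearMap.inl ℝ E ℝ)) x := by
  have hf' : Continuous fun y => (fderiv ℝ f y).comp (ContinuousLinearMap.inl ℝ E ℝ) :=
    (hf.continuous_fderiv (by simp)).clm_comp continuous_const
  obtain ⟨C, hC⟩ := ((isCompact_closedBall x (1:ℝ)).prod
    (isCompact_Icc (a := (0:ℝ)) (b := 1))).exists_bound_of_continuousOn hf'.continuousOn
  have hslice (y : E) : Continuous fun s : ℝ => (y, s) := by fun_prop
  refine intervalIntegral.hasFDerivAt_integral_of_dominated_of_fderiv_le (𝕜 := ℝ)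
    (bound := fun _ => C) (Metric.closedBall_mem_nhds x one_pos)
    (Filter.Eventually.of_forall fun y => (hf.continuous.comp (hslice y)).aestronglyMeasurable)
    ((hf.continuous.comp (hslice x)).intervalIntegrable _ _)
    (hf'.comp (hslice x)).aestronglyMeasurable
    (Filter.Eventually.of_forall fun s hs y hy => hC (y, s) ⟨hy, ?_⟩) intervalIntegrable_const
    (Filter.Eventually.of_forall fun s _ y _ => ?_)
  · rw [Set.uIoc_of_le zero_le_one] at hs
    exact ⟨hs.1.le, hs.2⟩
  · exact (hf.differentiable (by simp) (y, s)).hasFDerivAt.comp y (hasFDerivAt_prodMk_left y s)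

theorem contDiff_integral_of_contDiff (hf : ContDiff ℝ ∞ f) :
    ContDiff ℝ ∞ fun x => ∫ s in (0:ℝ)..1, f (x, s) := by
  rw [contDiff_infty]
  intro N
  induction N generalizing F with
  | zero =>
    exact contDiff_zero.2 (continuous_iff_continuousAt.2 fun x =>
      (hasFDerivAt_integral_of_contDiff hf x).continuousAt)
  | succ N ih =>
    push_cast
    rw [contDiff_succ_iff_fderiv]
    refine ⟨fun x => (hasFDerivAt_integral_of_contDiff hf x).differentiableAt, by simp, ?_⟩
    rw [funext fun x => (hasFDerivAt_integral_of_contDiff hf x).fderiv]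
    exact ih (f := fun y => (fderiv ℝ f y).comp (ContinuousLinearMap.inl ℝ E ℝ))
      ((hf.fderiv_right (by simp)).clm_comp contDiff_const)

end ParametricIntegral

/-- `Finset.restrict` at a constant type family, which elaborates without unification hints. -/
abbrev restr {ι : Type*} (S : Finset ι) (p : ι → ℝ) : S → ℝ := S.restrict p

section FinitelyManyVariables

variable {ι : Type} [DecidableEq ι] {f : (ι → ℝ) → ℝ} {S : Finset ι} {g : (S → ℝ) → ℝ}

theorem hasDerivAt_restr_update (S : Finset ι) (p : ι → ℝ) (z : ι) (s : ℝ) :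
    HasDerivAt (fun s => restr S (Function.update p z s)) (restr S (Pi.single z 1)) s := by
  rw [hasDerivAt_pi]
  rintro ⟨y, hy⟩
  by_cases h : y = z
  · subst h; simpa using hasDerivAt_id' s
  · simpa [h] using hasDerivAt_const s (p y)

theorem hasDerivAt_update_of_contDiff (hg : ContDiff ℝ ∞ g) (hf : ∀ p, f p = g (restr S p))
    (z : ι) (p : ι → ℝ) (s : ℝ) : HasDerivAt (fun s => f (Function.update p z s))
      (fderiv ℝ g (restr S (Function.update p z s)) (restr S (Pi.single z 1))) s := by
  simp only [hf]
  exact (hg.differentiable (by simp) _).hasFDerivAt.comp_hasDerivAt s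
    (hasDerivAt_restr_update S p z s)

theorem pd_eq_fderiv (hg : ContDiff ℝ ∞ g) (hf : ∀ p, f p = g (restr S p)) (z : ι)
    (p : ι → ℝ) : pd z f p = fderiv ℝ g (restr S p) (restr S (Pi.single z 1)) := by
  have := (hasDerivAt_update_of_contDiff hg hf z p (p z)).deriv
  rwa [Function.update_eq_self] at this

theorem fderiv_restr_eq_sum (hg : ContDiff ℝ ∞ g) (hf : ∀ p, f p = g (restr S p))
    (p v : ι → ℝ) : fderiv ℝ g (restr S p) (restr S v) = ∑ z ∈ S, v z * pd z f p := by
  have hv : restr S v = ∑ z : S, v z • restr S (Pi.single (z : ι) 1) := by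
    ext y
    simp [Pi.single_apply]
  rw [← Finset.sum_coe_sort S (fun z => v z * pd z f p), hv, map_sum]
  simp only [map_smul, smul_eq_mul, pd_eq_fderiv hg hf]

end FinitelyManyVariables

theorem IsDiffFun.exists_superset {f : Fun n m} (hf : IsDiffFun f) (T : Finset (Coord n m)) :
    ∃ S, T ⊆ S ∧ ∃ g : (S → ℝ) → ℝ, ContDiff ℝ ∞ g ∧ ∀ p, f p = g (restr S p) := by
  obtain ⟨S, g, hg, hfg⟩ := hf
  exact ⟨T ∪ S, Finset.subset_union_left,
    fun q => g fun z => q ⟨z, Finset.subset_union_right z.2⟩, hg.comp (by fun_prop), hfg⟩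

theorem IsDiffFun.exists_common {f g : Fun n m} (hf : IsDiffFun f) (hg : IsDiffFun g) :
    ∃ (S : Finset (Coord n m)) (f' g' : (S → ℝ) → ℝ), ContDiff ℝ ∞ f' ∧ ContDiff ℝ ∞ g' ∧
      (∀ p, f p = f' (restr S p)) ∧ ∀ p, g p = g' (restr S p) := by
  obtain ⟨T, f', hf', h1⟩ := hf
  obtain ⟨S, hTS, g', hg', h2⟩ := hg.exists_superset T
  exact ⟨S, fun q => f' fun z => q ⟨z, hTS z.2⟩, g', hf'.comp (by fun_prop), hg', h1, h2⟩

variable (n m) in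
/-- The algebra of differential functions, as a subalgebra of all functions of the coordinates. -/
def diffFunAlg : Subalgebra ℝ (Fun n m) where
  carrier := {f | IsDiffFun f}
  mul_mem' := fun hf hg => by
    obtain ⟨S, f', g', hf', hg', h1, h2⟩ := hf.exists_common hg
    exact ⟨S, f' * g', hf'.mul hg', fun p => congrArg₂ _ (h1 p) (h2 p)⟩
  add_mem' := fun hf hg => by
    obtain ⟨S, f', g', hf', hg', h1, h2⟩ := hf.exists_common hg
    exact ⟨S, f' + g', hf'.add hg', fun p => congrArg₂ _ (h1 p) (h2 p)⟩
  algebraMap_mem' := fun r => ⟨∅, fun _ => r, contDiff_const, fun _ => rfl⟩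

variable (n m) in
/-- The algebra of differential functions, as a type of its own: hidden from instance search,
it avoids the competing structures that a coerced subalgebra inherits. -/
def DiffFun : Type := diffFunAlg n m

namespace DiffFun

instance : CommRing (DiffFun n m) := inferInstanceAs (CommRing (diffFunAlg n m))

instance : Algebra ℝ (DiffFun n m) := inferInstanceAs (Algebra ℝ (diffFunAlg n m))

instance : FunLike (DiffFun n m) (Coord n m → ℝ) ℝ := ⟨Subtype.val, Subtype.val_injective⟩

theorem isDiffFun (f : DiffFun n m) : IsDiffFun f := f.2

theorem ext {f g : DiffFun n m} (h : ∀ p, f p = g p) : f = g := DFunLike.ext f g h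

variable (f g : DiffFun n m) (p : Coord n m → ℝ)

@[simp] theorem add_apply : (f + g) p = f p + g p := rfl

@[simp] theorem sub_apply : (f - g) p = f p - g p := rfl

@[simp] theorem neg_apply : (-f) p = -f p := rfl

@[simp] theorem mul_apply : (f * g) p = f p * g p := rfl

@[simp] theorem smul_apply (r : ℝ) : (r • f) p = r * f p := rfl

@[simp] theorem zero_apply : (0 : DiffFun n m) p = 0 := rfl

@[simp] theorem one_apply : (1 : DiffFun n m) p = 1 := rfl

@[simp] theorem pow_apply (N : ℕ) : (f ^ N) p = f p ^ N := rfl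

@[simp] theorem algebraMap_apply (r : ℝ) : algebraMap ℝ (DiffFun n m) r p = r := rfl

@[simp] theorem sum_apply {α : Type*} (s : Finset α) (f : α → DiffFun n m) :
    (∑ a ∈ s, f a) p = ∑ a ∈ s, f a p := by
  classical
  induction s using Finset.induction_on with
  | empty => simp
  | insert a s ha ih => simp [Finset.sum_insert ha, ih]

end DiffFun

/-- The coordinate `z` as a differential function. -/
def coord (z : Coord n m) : DiffFun n m :=
  ⟨fun p => p z, {z}, fun q => q ⟨z, by simp⟩, by fun_prop, fun _ => rfl⟩

@[simp] theorem coord_apply (z : Coord n m) (p : Coord n m → ℝ) : coord z p = p z := rfl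

theorem IsDiffFun.pd {f : Fun n m} (hf : IsDiffFun f) (z : Coord n m) : IsDiffFun (pd z f) := by
  obtain ⟨S, g, hg, h⟩ := hf
  exact ⟨S, fun q => fderiv ℝ g q (restr S (Pi.single z 1)),
    (hg.fderiv_right (m := ∞) (by simp)).clm_apply contDiff_const, fun p => pd_eq_fderiv hg h z p⟩

theorem IsDiffFun.hasDerivAt_update {f : Fun n m} (hf : IsDiffFun f) (z : Coord n m)
    (p : Coord n m → ℝ) :
    HasDerivAt (fun s => f (Function.update p z s)) (Brusselator.pd z f p) (p z) := by
  obtain ⟨S, g, hg, h⟩ := hf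
  have := hasDerivAt_update_of_contDiff hg h z p (p z)
  rwa [Function.update_eq_self, ← pd_eq_fderiv hg h] at this

/-- The partial derivatives as derivations of the algebra of differential functions. -/
def partialDeriv (z : Coord n m) : Derivation ℝ (DiffFun n m) (DiffFun n m) :=
  Derivation.mk'
    { toFun := fun f => ⟨pd z f, f.isDiffFun.pd z⟩
      map_add' := fun f g => DiffFun.ext fun p =>
        ((f.isDiffFun.hasDerivAt_update z p).add (g.isDiffFun.hasDerivAt_update z p)).deriv
      map_smul' := fun r f => DiffFun.ext fun p =>
        ((f.isDiffFun.hasDerivAt_update z p).const_mul r).deriv }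
    fun f g => DiffFun.ext fun p => by
      have := ((f.isDiffFun.hasDerivAt_update z p).mul (g.isDiffFun.hasDerivAt_update z p)).deriv
      simp only [Function.update_eq_self] at this
      refine this.trans ?_
      change _ = f p * pd z g p + g p * pd z f p
      ring

theorem partialDeriv_apply (z : Coord n m) (f : DiffFun n m) (p : Coord n m → ℝ) :
    partialDeriv z f p = pd z f p := rfl

theorem partialDeriv_comm (y z : Coord n m) (f : DiffFun n m) :
    partialDeriv y (partialDeriv z f) = partialDeriv z (partialDeriv y f) := by
  obtain ⟨S, g, hg, h⟩ := f.isDiffFun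
  have hg' : ContDiff ℝ ∞ (fderiv ℝ g) := hg.fderiv_right (by simp)
  have key (y z : Coord n m) (p : Coord n m → ℝ) : pd y (pd z f) p =
      fderiv ℝ (fderiv ℝ g) (restr S p) (restr S (Pi.single y 1))
        (restr S (Pi.single z 1)) := by
    rw [pd_eq_fderiv (g := fun q => fderiv ℝ g q (restr S (Pi.single z 1)))
      (hg'.clm_apply contDiff_const) (fun p => pd_eq_fderiv hg h z p),
      fderiv_clm_apply (hg'.differentiable (by simp) _) (by fun_prop)]
    simp
  have hsymm (p : Coord n m → ℝ) : IsSymmSndFDerivAt ℝ g (restr S p) :=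
    hg.contDiffAt.isSymmSndFDerivAt (by
      rw [minSmoothness_of_isRCLikeNormedField]; exact WithTop.coe_le_coe.2 le_top)
  exact DiffFun.ext fun p => (key y z p).trans ((hsymm p _ _).trans (key z y p).symm)

theorem partialDeriv_coord (y z : Coord n m) :
    partialDeriv y (coord z) = if y = z then 1 else 0 := by
  refine DiffFun.ext fun p => ?_
  change deriv (fun s => Function.update p y s z) (p y) = _
  by_cases h : y = z
  · subst h; simp
  · simp [h, Function.update_of_ne (Ne.symm h)]

theorem finite_setOf_partialDeriv_ne_zero (f : DiffFun n m) :
    {z | partialDeriv z f ≠ 0}.Finite := by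
  obtain ⟨S, g, hg, h⟩ := f.isDiffFun
  refine S.finite_toSet.subset fun z hz => ?_
  by_contra hzS
  refine hz (DiffFun.ext fun p => ?_)
  have hz0 : restr S (Pi.single z (1:ℝ)) = 0 :=
    funext fun y => Pi.single_eq_of_ne (fun e : (y : Coord n m) = z => hzS (e ▸ y.2)) _
  rw [partialDeriv_apply, pd_eq_fderiv hg h, hz0, map_zero, DiffFun.zero_apply]

section Scale

variable {ι : Type*}

/-- Multiplication by `r` of the coordinates selected by the Boolean predicate `Z`: the homotopy
that contracts these coordinates to zero. -/
def scale (Z : ι → Bool) (r : ℝ) (p : ι → ℝ) : ι → ℝ :=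
  fun z => if Z z then r * p z else p z

@[simp] theorem scale_one (Z : ι → Bool) (p : ι → ℝ) : scale Z 1 p = p := by
  funext z; simp [scale]

theorem restr_scale (S : Finset ι) (Z : ι → Bool) (r : ℝ) (p : ι → ℝ) :
    restr S (scale Z r p) = scale (fun z : S => Z z) r (restr S p) := rfl

theorem scale_zero_update [DecidableEq ι] {Z : ι → Bool} {z : ι} (hz : Z z = true) (p : ι → ℝ)
    (s : ℝ) : scale Z 0 (Function.update p z s) = scale Z 0 p := by
  funext y
  by_cases hy : y = z
  · subst hy; simp [scale, hz]
  · simp [scale, hy]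

theorem scale_update [DecidableEq ι] (Z : ι → Bool) (r : ℝ) (p : ι → ℝ) (z : ι) (s : ℝ) :
    scale Z r (Function.update p z s) =
      Function.update (scale Z r p) z ((if Z z then r else 1) * s) := by
  funext y
  by_cases hy : y = z
  · subst hy; by_cases h : Z y <;> simp [scale, h]
  · simp [scale, hy]

theorem contDiff_scale [Fintype ι] (Z : ι → Bool) :
    ContDiff ℝ ∞ fun y : (ι → ℝ) × ℝ => scale Z y.2 y.1 := by
  rw [contDiff_pi]
  intro z
  unfold scale
  split_ifs <;> fun_prop

end Scale

theorem DiffFun.continuous_comp_scale (f : DiffFun n m) (Z : Coord n m → Bool)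
    (p : Coord n m → ℝ) : Continuous fun r => f (scale Z r p) := by
  obtain ⟨S, g, hg, h⟩ := f.isDiffFun
  have h' : ∀ p, f p = g (restr S p) := h
  simp only [h', restr_scale]
  exact hg.continuous.comp ((contDiff_scale _).continuous.comp
    (by fun_prop : Continuous fun r : ℝ => (restr S p, r)))

theorem DiffFun.pd_comp_scale (f : DiffFun n m) (Z : Coord n m → Bool) (r : ℝ) (z : Coord n m)
    (p : Coord n m → ℝ) : pd z (fun p => f (scale Z r p)) p =
      (if Z z then r else 1) * partialDeriv z f (scale Z r p) := by
  have hz : scale Z r p z = (if Z z then r else 1) * p z := by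
    by_cases h : Z z <;> simp [scale, h]
  have hf := f.isDiffFun.hasDerivAt_update z (scale Z r p)
  rw [hz] at hf
  have hcomp := hf.comp (p z) ((hasDerivAt_id' (p z)).const_mul (if Z z then r else 1))
  change deriv (fun s => f (scale Z r (Function.update p z s))) (p z) = _
  simp only [scale_update]
  exact hcomp.deriv.trans (by rw [mul_one, mul_comm, partialDeriv_apply])

/-- The average of `f` over the rescalings of the coordinates selected by `Z`. -/
def scaleAvg (Z : Coord n m → Bool) : DiffFun n m →ₗ[ℝ] DiffFun n m where
  toFun f := ⟨fun p => ∫ r in (0:ℝ)..1, f (scale Z r p), by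
    obtain ⟨S, g, hg, h⟩ := f.isDiffFun
    have h' : ∀ p, f p = g (restr S p) := h
    simp only [h', restr_scale]
    exact ⟨S, fun q => ∫ r in (0:ℝ)..1, g (scale (fun z : S => Z z) r q),
      contDiff_integral_of_contDiff
        (f := fun y : (S → ℝ) × ℝ => g (scale (fun z : S => Z z) y.2 y.1))
        (hg.comp (contDiff_scale _)), fun p => rfl⟩⟩
  map_add' f g := DiffFun.ext fun p =>
    intervalIntegral.integral_add ((f.continuous_comp_scale Z p).intervalIntegrable _ _)
      ((g.continuous_comp_scale Z p).intervalIntegrable _ _)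
  map_smul' c f := DiffFun.ext fun p => intervalIntegral.integral_const_mul c _

theorem scaleAvg_apply (Z : Coord n m → Bool) (f : DiffFun n m) (p : Coord n m → ℝ) :
    scaleAvg Z f p = ∫ r in (0:ℝ)..1, f (scale Z r p) := rfl

theorem partialDeriv_scaleAvg_apply (Z : Coord n m → Bool) (f : DiffFun n m) (z : Coord n m)
    (p : Coord n m → ℝ) : partialDeriv z (scaleAvg Z f) p =
      ∫ r in (0:ℝ)..1, (if Z z then r else 1) * partialDeriv z f (scale Z r p) := by
  obtain ⟨S, g, hg, h⟩ := f.isDiffFun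
  set ZS : S → Bool := fun z => Z z
  set F : (S → ℝ) × ℝ → ℝ := fun y => g (scale ZS y.2 y.1)
  have hF : ContDiff ℝ ∞ F := hg.comp (contDiff_scale _)
  have hfF (r : ℝ) (p : Coord n m → ℝ) : f (scale Z r p) = F (restr S p, r) := h _
  have hslice (r : ℝ) : (fderiv ℝ F (restr S p, r)).comp (ContinuousLinearMap.inl ℝ (S → ℝ) ℝ)
      (restr S (Pi.single z 1)) = pd z (fun p => f (scale Z r p)) p := by
    rw [pd_eq_fderiv (hF.comp (contDiff_prodMk_left r)) (hfF r)]
    exact congrArg (fun L => L (restr S (Pi.single z 1)))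
      ((hF.differentiable (by simp) _).hasFDerivAt.comp _ (hasFDerivAt_prodMk_left _ r)).fderiv.symm
  have havg (p : Coord n m → ℝ) :
      scaleAvg Z f p = (fun q => ∫ r in (0:ℝ)..1, F (q, r)) (restr S p) := by
    simp only [scaleAvg_apply, hfF]
  rw [partialDeriv_apply, pd_eq_fderiv (contDiff_integral_of_contDiff hF) havg,
    (hasFDerivAt_integral_of_contDiff hF _).fderiv, ContinuousLinearMap.intervalIntegral_apply]
  · simp only [hslice, f.pd_comp_scale]
  · refine Continuous.intervalIntegrable ?_ _ _
    exact ((hF.continuous_fderiv (by simp)).comp (by fun_prop : Continuous fun s : ℝ =>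
      (restr S p, s))).clm_comp continuous_const

theorem partialDeriv_scaleAvg_of_not (Z : Coord n m → Bool) (f : DiffFun n m) {z : Coord n m}
    (hz : Z z = false) : partialDeriv z (scaleAvg Z f) = scaleAvg Z (partialDeriv z f) :=
  DiffFun.ext fun p => by simp [partialDeriv_scaleAvg_apply, scaleAvg_apply, hz]

theorem coord_mul_partialDeriv_scaleAvg (Z : Coord n m → Bool) (f : DiffFun n m)
    {y z : Coord n m} (hy : Z y = true) (hz : Z z = true) :
    coord y * partialDeriv z (scaleAvg Z f) = scaleAvg Z (coord y * partialDeriv z f) :=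
  DiffFun.ext fun p => by
    rw [DiffFun.mul_apply, coord_apply, partialDeriv_scaleAvg_apply, scaleAvg_apply,
      ← intervalIntegral.integral_const_mul]
    congr 1
    funext r
    simp only [DiffFun.mul_apply, coord_apply, scale, hy, hz, if_true]
    ring

theorem hasDerivAt_comp_scale (Z : Coord n m → Bool) (f : DiffFun n m) (S : Finset (Coord n m))
    (hS : ∀ z, Z z = true → z ∉ S → partialDeriv z f = 0) (p : Coord n m → ℝ) (r : ℝ) :
    HasDerivAt (fun r => f (scale Z r p))
      (∑ z ∈ S with Z z, p z * partialDeriv z f (scale Z r p)) r := by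
  obtain ⟨T, hST, g, hg, h⟩ := f.isDiffFun.exists_superset S
  set v : Coord n m → ℝ := fun z => if Z z then p z else 0
  have hscale : HasDerivAt (fun r => restr T (scale Z r p)) (restr T v) r := by
    rw [hasDerivAt_pi]
    intro z
    by_cases hz : Z z
    · simpa [scale, v, hz] using (hasDerivAt_id' r).mul_const (p z)
    · simpa [scale, v, hz] using hasDerivAt_const r (p z)
  have hcomp := (hg.differentiable (by simp) _).hasFDerivAt.comp_hasDerivAt r hscale
  rw [fderiv_restr_eq_sum hg h] at hcomp
  simp only [h]
  refine hcomp.congr_deriv ?_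
  simp only [v, ite_mul, zero_mul, Finset.sum_filter]
  refine (Finset.sum_subset hST fun z _ hz => ?_).symm
  by_cases hZ : Z z
  · rw [if_pos hZ, ← partialDeriv_apply, hS z hZ hz, DiffFun.zero_apply, mul_zero]
  · simp [hZ]

/-- The restriction of `f` to the points where the coordinates selected by `Z` vanish. -/
def atZero (Z : Coord n m → Bool) (f : DiffFun n m) : DiffFun n m :=
  ⟨fun p => f (scale Z 0 p), by
    obtain ⟨S, g, hg, h⟩ := f.isDiffFun
    exact ⟨S, fun q => g (scale (fun z : S => Z z) 0 q),
      hg.comp ((contDiff_scale _).comp (contDiff_prodMk_left (0:ℝ))), fun p => h _⟩⟩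

theorem partialDeriv_atZero (Z : Coord n m → Bool) (f : DiffFun n m) {z : Coord n m}
    (hz : Z z = true) : partialDeriv z (atZero Z f) = 0 := by
  refine DiffFun.ext fun p => ?_
  change deriv (fun s => f (scale Z 0 (Function.update p z s))) (p z) = 0
  simp only [scale_zero_update hz, deriv_const]

theorem sub_atZero (Z : Coord n m → Bool) (f : DiffFun n m) (S : Finset (Coord n m))
    (hS : ∀ z, Z z = true → z ∉ S → partialDeriv z f = 0) :
    f - atZero Z f = ∑ z ∈ S with Z z, coord z * scaleAvg Z (partialDeriv z f) := by
  refine DiffFun.ext fun p => ?_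
  have hcont (z : Coord n m) : Continuous fun r => p z * partialDeriv z f (scale Z r p) :=
    continuous_const.mul ((partialDeriv z f).continuous_comp_scale Z p)
  have hftc := intervalIntegral.integral_eq_sub_of_hasDerivAt (a := 0) (b := 1)
    (fun r _ => hasDerivAt_comp_scale Z f S hS p r)
    ((continuous_finsetSum _ fun z _ => hcont z).intervalIntegrable _ _)
  rw [scale_one, intervalIntegral.integral_finsetSum
    fun z _ => (hcont z).intervalIntegrable _ _] at hftc
  simp only [intervalIntegral.integral_const_mul] at hftc
  rw [DiffFun.sum_apply]
  exact hftc.symm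

theorem scaleAvg_add_coord_mul_partialDeriv (z : Coord n m) (f : DiffFun n m) :
    scaleAvg (fun y => decide (y = z)) (f + coord z * partialDeriv z f) = f := by
  refine DiffFun.ext fun p => ?_
  set Z : Coord n m → Bool := fun y => decide (y = z)
  have hderiv (r : ℝ) : HasDerivAt (fun r => r * f (scale Z r p))
      ((f + coord z * partialDeriv z f) (scale Z r p)) r := by
    have := (hasDerivAt_id' r).mul (hasDerivAt_comp_scale Z f {z}
      (fun y hy hy' => absurd (by simpa [Z] using hy) (by simpa using hy')) p r)
    rw [Finset.filter_singleton, if_pos (by simp [Z]), Finset.sum_singleton] at this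
    refine this.congr_deriv ?_
    simp only [scale, Z, DiffFun.add_apply, DiffFun.mul_apply, coord_apply, decide_true, if_true]
    ring
  rw [scaleAvg_apply, intervalIntegral.integral_eq_sub_of_hasDerivAt (fun r _ => hderiv r)
    ((DiffFun.continuous_comp_scale _ Z p).intervalIntegrable _ _)]
  simp

/-- The antiderivative of `f` in the coordinate `z` that vanishes at `z = 0`. -/
def antideriv (z : Coord n m) (f : DiffFun n m) : DiffFun n m :=
  coord z * scaleAvg (fun y => decide (y = z)) f

theorem partialDeriv_antideriv_self (z : Coord n m) (f : DiffFun n m) :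
    partialDeriv z (antideriv z f) = f := by
  conv_rhs => rw [← scaleAvg_add_coord_mul_partialDeriv z f]
  rw [antideriv, Derivation.leibniz, partialDeriv_coord, if_pos rfl, smul_eq_mul, smul_eq_mul,
    mul_one, coord_mul_partialDeriv_scaleAvg _ _ (by simp) (by simp), map_add, add_comm]

theorem partialDeriv_antideriv_of_ne {y z : Coord n m} (h : y ≠ z) (f : DiffFun n m) :
    partialDeriv y (antideriv z f) = antideriv z (partialDeriv y f) := by
  rw [antideriv, Derivation.leibniz, partialDeriv_coord, if_neg h, smul_eq_mul, smul_eq_mul,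
    mul_zero, add_zero, partialDeriv_scaleAvg_of_not _ _ (by simpa using h), antideriv]

theorem antideriv_zero (z : Coord n m) : antideriv z (0 : DiffFun n m) = 0 := by simp [antideriv]

theorem multiIndex_induction {ι : Type*} [Finite ι] [DecidableEq ι] {P : (ι → ℕ) → Prop}
    (zero : P 0) (add_single : ∀ K i, P K → P (K + Pi.single i 1)) (K : ι → ℕ) : P K := by
  cases nonempty_fintype ι
  induction h : ∑ i, K i generalizing K with
  | zero =>
    obtain rfl : K = 0 := funext fun i => Finset.sum_eq_zero_iff.1 h i (Finset.mem_univ i)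
    exact zero
  | succ N ih =>
    obtain ⟨i, hi⟩ : ∃ i, K i ≠ 0 := by
      by_contra! hK
      simp [hK] at h
    have hle : Pi.single i 1 ≤ K :=
      update_le_iff.2 ⟨Nat.one_le_iff_ne_zero.2 hi, fun _ _ => Nat.zero_le _⟩
    have hsum := congrArg (fun L : ι → ℕ => ∑ j, L j) (tsub_add_cancel_of_le hle)
    simp only [Pi.add_apply, Finset.sum_add_distrib, Finset.sum_pi_single', Finset.mem_univ,
      if_true, h] at hsum
    rw [← tsub_add_cancel_of_le hle]
    exact add_single _ _ (ih _ (by omega))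

section Monomials

variable {R M M' : Type*} [Semiring R] [AddCommMonoid M] [Module R M] [AddCommMonoid M']
  [Module R M']

/-- The monomial `T_1^{K_1} ⋯ T_n^{K_n}` of a family of endomorphisms. -/
def endMonomial (T : Fin n → Module.End R M) (K : Fin n → ℕ) : Module.End R M :=
  ((List.finRange n).map fun i => T i ^ K i).prod

@[simp] theorem endMonomial_zero (T : Fin n → Module.End R M) : endMonomial T 0 = 1 := by
  simp [endMonomial]

theorem endMonomial_add_single {T : Fin n → Module.End R M} (hT : ∀ i j, Commute (T i) (T j))
    (K : Fin n → ℕ) (i : Fin n) :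
    endMonomial T (K + Pi.single i 1) = T i * endMonomial T K := by
  have key (l : List (Fin n)) (hl : l.Nodup) :
      (l.map fun j => T j ^ (K + Pi.single i 1 : Fin n → ℕ) j).prod =
        (if i ∈ l then T i else 1) * (l.map fun j => T j ^ K j).prod := by
    induction l with
    | nil => simp
    | cons j l ih =>
      rw [List.nodup_cons] at hl
      rw [List.map_cons, List.prod_cons, ih hl.2, List.map_cons, List.prod_cons]
      by_cases hj : j = i
      · subst hj
        simp [hl.1, pow_succ', mul_assoc]
      · have hc : Commute (T j ^ K j) (if i ∈ l then T i else 1) := by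
          split_ifs
          · exact (hT j i).pow_left _
          · exact Commute.one_right _
        simp only [Pi.add_apply, Pi.single_eq_of_ne hj, add_zero, List.mem_cons, Ne.symm hj,
          false_or]
        rw [← mul_assoc, hc.eq, mul_assoc]
  simpa [endMonomial] using key _ (List.nodup_finRange n)

theorem map_endMonomial {T : Fin n → Module.End R M} {T' : Fin n → Module.End R M'}
    (φ : M →ₗ[R] M') (h : ∀ i x, φ (T i x) = T' i (φ x)) (K : Fin n → ℕ) (x : M) :
    φ (endMonomial T K x) = endMonomial T' K (φ x) := by
  have hpow (i : Fin n) (N : ℕ) (y : M) : φ ((T i ^ N) y) = (T' i ^ N) (φ y) := by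
    induction N with
    | zero => rfl
    | succ N ih => rw [pow_succ', pow_succ', Module.End.mul_apply, Module.End.mul_apply, h, ih]
  have key (l : List (Fin n)) : φ ((l.map fun i => T i ^ K i).prod x) =
      (l.map fun i => T' i ^ K i).prod (φ x) := by
    induction l with
    | nil => rfl
    | cons j l ih => simp only [List.map_cons, List.prod_cons, Module.End.mul_apply, hpow, ih]
  exact key _

end Monomials

variable (n m) in
/-- Finitely supported families of differential functions indexed by multi-indices. They encode
differential operators `∑_I h_I D_x^I`. -/
abbrev Jet : Type := (Fin n → ℕ) →₀ DiffFun n m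

theorem coord_u_injective (k : Fin m) : Function.Injective (Coord.u (n := n) k) :=
  fun _ _ h => by cases h; rfl

/-- The family of all partial derivatives `∂f/∂u^k_I`: the linearization of `f` in `u^k`. -/
def jetDeriv (k : Fin m) : Derivation ℝ (DiffFun n m) (Jet n m) :=
  have hfin (f : DiffFun n m) : (Function.support fun I => partialDeriv (.u k I) f).Finite :=
    (finite_setOf_partialDeriv_ne_zero f).preimage (coord_u_injective k).injOn
  Derivation.mk'
    { toFun := fun f => Finsupp.ofSupportFinite (fun I => partialDeriv (.u k I) f) (hfin f)
      map_add' := fun f g => Finsupp.ext fun I => (partialDeriv (.u k I)).map_add f g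
      map_smul' := fun r f => Finsupp.ext fun I => (partialDeriv (.u k I)).map_smul r f }
    fun f g => Finsupp.ext fun I => (partialDeriv (.u k I)).leibniz f g

@[simp] theorem jetDeriv_apply (k : Fin m) (f : DiffFun n m) (I : Fin n → ℕ) :
    jetDeriv k f I = partialDeriv (.u k I) f := rfl

theorem jetDeriv_coord (j k : Fin m) (I : Fin n → ℕ) :
    jetDeriv j (coord (.u k I) : DiffFun n m) = if j = k then Finsupp.single I 1 else 0 := by
  ext1 K
  rw [jetDeriv_apply, partialDeriv_coord]
  by_cases hk : j = k
  · simp [hk, Finsupp.single_apply, eq_comm]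
  · simp [hk]

/-- The shift of a family by the multi-index `1_i`. -/
def shift (i : Fin n) : Jet n m →ₗ[DiffFun n m] Jet n m :=
  Finsupp.lmapDomain (DiffFun n m) (DiffFun n m) (· + Pi.single i 1)

@[simp] theorem shift_single (i : Fin n) (K : Fin n → ℕ) (g : DiffFun n m) :
    shift i (Finsupp.single K g) = Finsupp.single (K + Pi.single i 1) g := by
  simp [shift]

theorem shift_apply_add (i : Fin n) (h : Jet n m) (K : Fin n → ℕ) :
    shift i h (K + Pi.single i 1) = h K :=
  Finsupp.mapDomain_apply (add_left_injective _) h K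

theorem shift_apply_of_eq_zero {i : Fin n} (h : Jet n m) {K : Fin n → ℕ} (hK : K i = 0) :
    shift i h K = 0 := by
  refine Finsupp.mapDomain_of_notMem_range h K ?_
  rintro ⟨J, rfl⟩
  simp at hK

/-- Entrywise application of a linear map. -/
def entrywise (φ : DiffFun n m →ₗ[ℝ] DiffFun n m) : Jet n m →ₗ[ℝ] Jet n m :=
  Finsupp.mapRange.linearMap φ

@[simp] theorem entrywise_apply (φ : DiffFun n m →ₗ[ℝ] DiffFun n m) (h : Jet n m)
    (K : Fin n → ℕ) : entrywise φ h K = φ (h K) := by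
  simp [entrywise]

@[simp] theorem entrywise_single (φ : DiffFun n m →ₗ[ℝ] DiffFun n m) (K : Fin n → ℕ)
    (g : DiffFun n m) : entrywise φ (Finsupp.single K g) = Finsupp.single K (φ g) := by
  simp [entrywise]

theorem entrywise_shift (φ : DiffFun n m →ₗ[ℝ] DiffFun n m) (i : Fin n) (h : Jet n m) :
    entrywise φ (shift i h) = shift i (entrywise φ h) := by
  induction h using Finsupp.induction_linear with
  | zero => simp
  | add f g hf hg => simp only [map_add, hf, hg]
  | single K g => simp

/-- The sum `∑_I h_I a_I`: the differential operator encoded by `h`, applied to a function whose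
derivative `D_x^I` is `a_I`. -/
abbrev jetPairing (a : (Fin n → ℕ) → DiffFun n m) : Jet n m →ₗ[DiffFun n m] DiffFun n m :=
  Finsupp.linearCombination (DiffFun n m) a

theorem jetPairing_shift (a : (Fin n → ℕ) → DiffFun n m) (i : Fin n) (h : Jet n m) :
    jetPairing a (shift i h) = jetPairing (fun I => a (I + Pi.single i 1)) h := by
  induction h using Finsupp.induction_linear with
  | zero => simp
  | add f g hf hg => simp only [map_add, hf, hg]
  | single K g => simp

theorem derivation_jetPairing (δ : Derivation ℝ (DiffFun n m) (DiffFun n m))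
    (a : (Fin n → ℕ) → DiffFun n m) (h : Jet n m) :
    δ (jetPairing a h) = jetPairing (fun I => δ (a I)) h + jetPairing a (entrywise δ h) := by
  induction h using Finsupp.induction_linear with
  | zero => simp
  | add f g hf hg => simp only [map_add, hf, hg]; ring
  | single K g => simp [mul_comm]

theorem jetPairing_partialDeriv (k : Fin m) (a : (Fin n → ℕ) → DiffFun n m) (h : Jet n m)
    (K : Fin n → ℕ) : jetPairing (fun I => partialDeriv (.u k K) (a I)) h =
      Finsupp.linearCombination (DiffFun n m) (fun I => jetDeriv k (a I)) h K := by
  induction h using Finsupp.induction_linear with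
  | zero => simp
  | add f g hf hg => simp only [map_add, hf, hg, Finsupp.add_apply]
  | single K g => simp

theorem jetPairing_jetDeriv_eq_sum (k : Fin m) (a : (Fin n → ℕ) → DiffFun n m) (f : DiffFun n m)
    {S : Finset (Fin n → ℕ)} (hS : (jetDeriv k f).support ⊆ S) :
    jetPairing a (jetDeriv k f) = ∑ I ∈ S, a I * partialDeriv (.u k I) f := by
  rw [Finsupp.linearCombination_apply, Finsupp.sum_of_support_subset _ hS _ (by simp)]
  exact Finset.sum_congr rfl fun I _ => mul_comm _ _

/-- The derivation `∑_{k,I} a^k_I ∂/∂u^k_I`. Evolutionary vector fields are of this form, with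
`a^k_I = D_x^I(a^k)`. -/
def evolutionary (a : Fin m → (Fin n → ℕ) → DiffFun n m) :
    Derivation ℝ (DiffFun n m) (DiffFun n m) :=
  ∑ k, (jetPairing (a k)).compDer (jetDeriv k)

theorem evolutionary_apply (a : Fin m → (Fin n → ℕ) → DiffFun n m) (f : DiffFun n m) :
    evolutionary a f = ∑ k, jetPairing (a k) (jetDeriv k f) := by
  rw [evolutionary, ← Derivation.coeFnAddMonoidHom_apply, map_sum, Finset.sum_apply]
  rfl

theorem evolutionary_coord (a : Fin m → (Fin n → ℕ) → DiffFun n m) (k : Fin m) (I : Fin n → ℕ) :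
    evolutionary a (coord (.u k I)) = a k I := by
  rw [evolutionary_apply, Finset.sum_eq_single k (fun j _ hj => by simp [jetDeriv_coord, hj])
    (by simp)]
  simp [jetDeriv_coord]

theorem evolutionary_eq_finsum (a : Fin m → (Fin n → ℕ) → DiffFun n m) (f : DiffFun n m)
    (p : Coord n m → ℝ) : evolutionary a f p =
      ∑ᶠ kI : Fin m × (Fin n → ℕ), a kI.1 kI.2 p * pd (.u kI.1 kI.2) f p := by
  have hzero {k : Fin m} {I : Fin n → ℕ} (h : partialDeriv (.u k I) f = 0) :
      a k I p * pd (.u k I) f p = 0 := by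
    rw [← partialDeriv_apply, h, DiffFun.zero_apply, mul_zero]
  have hinj : Function.Injective fun kI : Fin m × (Fin n → ℕ) => Coord.u kI.1 kI.2 :=
    fun ⟨_, _⟩ ⟨_, _⟩ h => by cases h; rfl
  rw [finsum_curry _ (((finite_setOf_partialDeriv_ne_zero f).preimage hinj.injOn).subset
    fun _ h h0 => h (hzero h0)), finsum_eq_sum_of_fintype, evolutionary_apply, DiffFun.sum_apply]
  refine Finset.sum_congr rfl fun k _ => ?_
  rw [jetPairing_jetDeriv_eq_sum k _ f subset_rfl, DiffFun.sum_apply,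
    finsum_eq_sum_of_support_subset (s := (jetDeriv k f).support)]
  · rfl
  · intro I hI
    rw [Finset.mem_coe, Finsupp.mem_support_iff]
    exact fun h0 => hI (hzero h0)

theorem partialDeriv_evolutionary (z : Coord n m) (a : Fin m → (Fin n → ℕ) → DiffFun n m)
    (f : DiffFun n m) : partialDeriv z (evolutionary a f) = evolutionary a (partialDeriv z f) +
      ∑ k, jetPairing (fun I => partialDeriv z (a k I)) (jetDeriv k f) := by
  have hcomm (k : Fin m) : entrywise (partialDeriv z) (jetDeriv k f) =
      jetDeriv k (partialDeriv z f) := Finsupp.ext fun I => by simp [partialDeriv_comm z]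
  rw [evolutionary_apply, map_sum, evolutionary_apply, ← Finset.sum_add_distrib]
  refine Finset.sum_congr rfl fun k _ => ?_
  rw [derivation_jetPairing, hcomm, add_comm]

theorem jetDeriv_evolutionary (k : Fin m) (a : Fin m → (Fin n → ℕ) → DiffFun n m)
    (f : DiffFun n m) : jetDeriv k (evolutionary a f) = entrywise (evolutionary a) (jetDeriv k f) +
      ∑ j, Finsupp.linearCombination (DiffFun n m) (fun I => jetDeriv k (a j I))
        (jetDeriv j f) := by
  ext1 K
  rw [Finsupp.add_apply, Finsupp.finsetSum_apply, jetDeriv_apply, partialDeriv_evolutionary]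
  exact congrArg _ (Finset.sum_congr rfl fun j _ => jetPairing_partialDeriv k _ _ K)

/-- The total derivative with respect to `x i` as a derivation of the algebra of differential
functions. -/
def totalDx (i : Fin n) : Derivation ℝ (DiffFun n m) (DiffFun n m) :=
  partialDeriv (.x i) + evolutionary fun k I => coord (.u k (I + Pi.single i 1))

theorem totalDx_apply (i : Fin n) (f : DiffFun n m) : totalDx i f =
    partialDeriv (.x i) f + evolutionary (fun k I => coord (.u k (I + Pi.single i 1))) f := rfl

theorem totalDx_coord (i : Fin n) (k : Fin m) (I : Fin n → ℕ) :
    totalDx i (coord (.u k I)) = coord (.u k (I + Pi.single i 1)) := by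
  rw [totalDx_apply, partialDeriv_coord, if_neg (by simp), zero_add, evolutionary_coord]

/-- The total derivatives as linear endomorphisms, which can be composed to monomials. -/
abbrev totalDxEnd (i : Fin n) : Module.End ℝ (DiffFun n m) := (totalDx (m := m) i).toLinearMap

theorem coe_totalDx (i : Fin n) (f : DiffFun n m) : ⇑(totalDx i f) = Dx i f :=
  funext fun p => congrArg (pd (.x i) f p + ·) (evolutionary_eq_finsum _ f p)

theorem partialDeriv_totalDx_of_ne_u {z : Coord n m} (hz : ∀ k I, z ≠ .u k I) (i : Fin n)
    (f : DiffFun n m) : partialDeriv z (totalDx i f) = totalDx i (partialDeriv z f) := by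
  rw [totalDx_apply, totalDx_apply, map_add, partialDeriv_evolutionary, partialDeriv_comm z]
  simp [partialDeriv_coord, hz, Finsupp.linearCombination_apply]

theorem jetDeriv_totalDx (k : Fin m) (i : Fin n) (f : DiffFun n m) :
    jetDeriv k (totalDx i f) =
      entrywise (totalDxEnd i) (jetDeriv k f) + shift i (jetDeriv k f) := by
  rw [totalDx_apply, map_add, jetDeriv_evolutionary, ← add_assoc]
  congr 1
  · ext1 K
    simp [totalDx_apply, partialDeriv_comm (.x i)]
  · simp only [jetDeriv_coord]
    rw [Finset.sum_eq_single k (fun j _ hj => by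
      simp [hj.symm, Finsupp.linearCombination_apply]) (by simp)]
    simp only [if_true]
    induction jetDeriv k f using Finsupp.induction_linear with
    | zero => simp
    | add f g hf hg => simp only [map_add, hf, hg]
    | single K g => simp

theorem partialDeriv_totalDx_add (k : Fin m) (i : Fin n) (K : Fin n → ℕ) (f : DiffFun n m) :
    partialDeriv (.u k (K + Pi.single i 1)) (totalDx i f) =
      totalDx i (partialDeriv (.u k (K + Pi.single i 1)) f) + partialDeriv (.u k K) f := by
  have := DFunLike.congr_fun (jetDeriv_totalDx k i f) (K + Pi.single i 1)
  simpa [shift_apply_add] using this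

theorem partialDeriv_totalDx_of_eq_zero (k : Fin m) {i : Fin n} {K : Fin n → ℕ} (hK : K i = 0)
    (f : DiffFun n m) :
    partialDeriv (.u k K) (totalDx i f) = totalDx i (partialDeriv (.u k K) f) := by
  have := DFunLike.congr_fun (jetDeriv_totalDx k i f) K
  simpa [shift_apply_of_eq_zero _ hK] using this

theorem totalDx_comm_of_prolongation {z : Coord n m} (hz : ∀ k I, z ≠ .u k I) (i : Fin n)
    {a : Fin m → (Fin n → ℕ) → DiffFun n m}
    (ha : ∀ k I, totalDx i (a k I) = a k (I + Pi.single i 1)) (f : DiffFun n m) :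
    totalDx i (partialDeriv z f + evolutionary a f) =
      partialDeriv z (totalDx i f) + evolutionary a (totalDx i f) := by
  rw [map_add, partialDeriv_totalDx_of_ne_u hz, evolutionary_apply, map_sum, evolutionary_apply]
  congr 1
  refine Finset.sum_congr rfl fun k _ => ?_
  rw [derivation_jetPairing, jetDeriv_totalDx, map_add, jetPairing_shift]
  simp only [ha]
  rw [add_comm]

theorem totalDx_comm (i j : Fin n) (f : DiffFun n m) :
    totalDx i (totalDx j f) = totalDx j (totalDx i f) :=
  totalDx_comm_of_prolongation (by simp) i
    (fun k I => by rw [totalDx_coord, add_right_comm]) f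

theorem totalDxEnd_commute (i j : Fin n) :
    Commute (totalDxEnd i : Module.End ℝ (DiffFun n m)) (totalDxEnd j) :=
  LinearMap.ext fun f => totalDx_comm i j f

theorem neg_totalDxEnd_commute (i j : Fin n) :
    Commute (-totalDxEnd i : Module.End ℝ (DiffFun n m)) (-totalDxEnd j) :=
  LinearMap.ext fun f => by simp [totalDx_comm i j]

/-- The iterated total derivatives `D_x^I` as linear endomorphisms. -/
def totalDxI (I : Fin n → ℕ) : Module.End ℝ (DiffFun n m) := endMonomial totalDxEnd I

@[simp] theorem totalDxI_zero (f : DiffFun n m) : totalDxI 0 f = f := by simp [totalDxI]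

theorem totalDxI_add_single (I : Fin n → ℕ) (i : Fin n) (f : DiffFun n m) :
    totalDxI (I + Pi.single i 1) f = totalDx i (totalDxI I f) := by
  rw [totalDxI, endMonomial_add_single totalDxEnd_commute]
  rfl

theorem coe_totalDxI (I : Fin n → ℕ) (f : DiffFun n m) : ⇑(totalDxI I f) = DxI I f := by
  have hpow (i : Fin n) (N : ℕ) (f : DiffFun n m) : ⇑((totalDxEnd i ^ N) f) = (Dx i)^[N] f := by
    induction N with
    | zero => rfl
    | succ N ih =>
      rw [pow_succ', Module.End.mul_apply, Function.iterate_succ_apply', ← ih]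
      exact coe_totalDx i _
  have key (l : List (Fin n)) : ⇑((l.map fun i => totalDxEnd i ^ I i).prod f) =
      l.foldr (fun i h => (Dx i)^[I i] h) f := by
    induction l with
    | nil => rfl
    | cons j l ih =>
      rw [List.map_cons, List.prod_cons, Module.End.mul_apply, hpow, List.foldr_cons, ih]
  exact key _

/-- The total derivative with respect to `t` on the evolution system `∂u^k/∂t = F^k`, as a
derivation of the algebra of differential functions. -/
def totalDt (F : Fin m → DiffFun n m) : Derivation ℝ (DiffFun n m) (DiffFun n m) :=
  partialDeriv .t + evolutionary fun k I => totalDxI I (F k)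

theorem totalDt_apply (F : Fin m → DiffFun n m) (f : DiffFun n m) :
    totalDt F f = partialDeriv .t f + evolutionary (fun k I => totalDxI I (F k)) f := rfl

theorem totalDt_coord (F : Fin m → DiffFun n m) (k : Fin m) :
    totalDt F (coord (.u k 0)) = F k := by
  rw [totalDt_apply, partialDeriv_coord, if_neg (by simp), zero_add, evolutionary_coord,
    totalDxI_zero]

theorem coe_totalDt (F : Fin m → DiffFun n m) (f : DiffFun n m) :
    ⇑(totalDt F f) = Dt (fun k => ⇑(F k)) f := by
  funext p
  refine congrArg (pd .t f p + ·) ((evolutionary_eq_finsum _ f p).trans ?_)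
  simp only [coe_totalDxI]

theorem totalDx_totalDt_comm (F : Fin m → DiffFun n m) (i : Fin n) (f : DiffFun n m) :
    totalDx i (totalDt F f) = totalDt F (totalDx i f) :=
  totalDx_comm_of_prolongation (by simp) i (fun k I => (totalDxI_add_single I i (F k)).symm) f

section Assemble

variable {M : Type*} [AddCommGroup M] [Module ℝ M]

/-- The sum `∑_K T^K (ι h_K)` for a family `T` of endomorphisms. -/
def assemble (T : Fin n → Module.End ℝ M) (ι : DiffFun n m →ₗ[ℝ] M) : Jet n m →ₗ[ℝ] M :=
  Finsupp.lsum ℝ fun K => endMonomial T K ∘ₗ ι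

@[simp] theorem assemble_single (T : Fin n → Module.End ℝ M) (ι : DiffFun n m →ₗ[ℝ] M)
    (K : Fin n → ℕ) (g : DiffFun n m) :
    assemble T ι (Finsupp.single K g) = endMonomial T K (ι g) := by
  simp [assemble]

theorem assemble_shift {T : Fin n → Module.End ℝ M} (hT : ∀ i j, Commute (T i) (T j))
    (ι : DiffFun n m →ₗ[ℝ] M) (i : Fin n) (h : Jet n m) :
    assemble T ι (shift i h) = T i (assemble T ι h) := by
  induction h using Finsupp.induction_linear with
  | zero => simp
  | add f g hf hg => simp only [map_add, hf, hg]
  | single K g => simp [endMonomial_add_single hT]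

theorem assemble_entrywise {T : Fin n → Module.End ℝ M} {ι : DiffFun n m →ₗ[ℝ] M}
    {ψ : DiffFun n m →ₗ[ℝ] DiffFun n m} {φ : M →ₗ[ℝ] M} (hι : ∀ g, φ (ι g) = ι (ψ g))
    (hT : ∀ i x, φ (T i x) = T i (φ x)) (h : Jet n m) :
    assemble T ι (entrywise ψ h) = φ (assemble T ι h) := by
  induction h using Finsupp.induction_linear with
  | zero => simp
  | add f g hf hg => simp only [map_add, hf, hg]
  | single K g => simp [map_endMonomial φ hT, hι]

end Assemble

/-- The value `∑_K (-D_x)^K h_K` at `1` of the formal adjoint of the differential operator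
`∑_K h_K D_x^K`. -/
def jetAdjoint : Jet n m →ₗ[ℝ] DiffFun n m := assemble (fun i => -totalDxEnd i) LinearMap.id

theorem jetAdjoint_shift (i : Fin n) (h : Jet n m) :
    jetAdjoint (shift i h) = -totalDx i (jetAdjoint h) :=
  assemble_shift neg_totalDxEnd_commute _ i h

theorem jetAdjoint_entrywise (φ : DiffFun n m →ₗ[ℝ] DiffFun n m)
    (hφ : ∀ i f, φ (totalDx i f) = totalDx i (φ f)) (h : Jet n m) :
    jetAdjoint (entrywise φ h) = φ (jetAdjoint h) :=
  assemble_entrywise (ι := LinearMap.id) (ψ := φ) (φ := φ) (fun _ => rfl)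
    (fun i x => by simp [hφ]) h

theorem jetAdjoint_single_zero (g : DiffFun n m) : jetAdjoint (Finsupp.single 0 g) = g := by
  simp [jetAdjoint]

/-- The Euler operator `∑_I (-D_x)^I ∘ ∂/∂u^k_I`, whose value on the density of a conserved current
is the `k`-th component of the characteristic. -/
def eulerOp (k : Fin m) : DiffFun n m →ₗ[ℝ] DiffFun n m :=
  jetAdjoint ∘ₗ (jetDeriv (n := n) k).toLinearMap

theorem eulerOp_apply (k : Fin m) (f : DiffFun n m) : eulerOp k f = jetAdjoint (jetDeriv k f) := rfl

theorem eulerOp_totalDx (k : Fin m) (i : Fin n) (f : DiffFun n m) :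
    eulerOp k (totalDx i f) = 0 := by
  rw [eulerOp_apply, jetDeriv_totalDx, map_add, jetAdjoint_shift,
    jetAdjoint_entrywise (totalDxEnd i) (totalDx_comm i)]
  exact add_neg_cancel _

theorem jetAdjoint_smul_jetDeriv_totalDx (k : Fin m) (i : Fin n) (g h : DiffFun n m) :
    jetAdjoint (h • jetDeriv k (totalDx i g)) = jetAdjoint (-totalDx i h • jetDeriv k g) := by
  have hleibniz : h • jetDeriv k (totalDx i g) =
      entrywise (totalDxEnd i) (h • jetDeriv k g) + (-totalDx i h) • jetDeriv k g +
        shift i (h • jetDeriv k g) := by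
    rw [jetDeriv_totalDx, smul_add, (shift i).map_smul]
    congr 1
    ext1 K
    simp only [Finsupp.smul_apply, Finsupp.add_apply, entrywise_apply, jetDeriv_apply, smul_eq_mul,
      Derivation.coeFn_coe, Derivation.leibniz]
    ring
  rw [hleibniz, map_add, map_add, jetAdjoint_shift,
    jetAdjoint_entrywise (totalDxEnd i) (totalDx_comm i)]
  simp

theorem jetAdjoint_smul_jetDeriv_totalDxI (k : Fin m) (I : Fin n → ℕ) (g h : DiffFun n m) :
    jetAdjoint (h • jetDeriv k (totalDxI I g)) =
      jetAdjoint (endMonomial (fun i => -totalDxEnd i) I h • jetDeriv k g) := by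
  induction I using multiIndex_induction generalizing h with
  | zero => simp
  | add_single I i ih =>
    rw [totalDxI_add_single, jetAdjoint_smul_jetDeriv_totalDx, ih,
      endMonomial_add_single neg_totalDxEnd_commute]
    congr 2
    exact (map_endMonomial (-totalDxEnd i) (fun j x => by simp [totalDx_comm i j]) I h).symm

theorem jetDeriv_totalDt (F : Fin m → DiffFun n m) (k : Fin m) (f : DiffFun n m) :
    jetDeriv k (totalDt F f) = entrywise (totalDt F) (jetDeriv k f) +
      ∑ j, Finsupp.linearCombination (DiffFun n m) (fun I => jetDeriv k (totalDxI I (F j)))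
        (jetDeriv j f) := by
  rw [totalDt_apply, map_add, jetDeriv_evolutionary, ← add_assoc]
  congr 1
  ext1 K
  simp [totalDt_apply, partialDeriv_comm .t]

theorem eulerOp_totalDt (F : Fin m → DiffFun n m) (k : Fin m) (f : DiffFun n m) :
    eulerOp k (totalDt F f) =
      totalDt F (eulerOp k f) + ∑ j, jetAdjoint (eulerOp j f • jetDeriv k (F j)) := by
  rw [eulerOp_apply, jetDeriv_totalDt, map_add,
    jetAdjoint_entrywise (totalDt F) (fun i f => (totalDx_totalDt_comm F i f).symm), map_sum]
  congr 1
  refine Finset.sum_congr rfl fun j _ => ?_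
  rw [eulerOp_apply]
  induction jetDeriv j f using Finsupp.induction_linear with
  | zero => simp
  | add f g hf hg => simp only [map_add, hf, hg, add_smul]
  | single K g =>
    rw [Finsupp.linearCombination_single, jetAdjoint_smul_jetDeriv_totalDxI]
    simp [jetAdjoint]

/-- Differential functions that depend on the independent variables `t` and `x` only. -/
def UIndep (f : DiffFun n m) : Prop := ∀ k, jetDeriv k f = 0

theorem UIndep.evolutionary_eq_zero {f : DiffFun n m} (hf : UIndep f)
    (a : Fin m → (Fin n → ℕ) → DiffFun n m) : evolutionary a f = 0 := by
  rw [evolutionary_apply]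
  exact Finset.sum_eq_zero fun k _ => by rw [hf k, map_zero]

theorem UIndep.totalDx_eq {f : DiffFun n m} (hf : UIndep f) (i : Fin n) :
    totalDx i f = partialDeriv (.x i) f := by
  rw [totalDx_apply, hf.evolutionary_eq_zero, add_zero]

theorem UIndep.totalDt_eq {f : DiffFun n m} (hf : UIndep f) (F : Fin m → DiffFun n m) :
    totalDt F f = partialDeriv .t f := by
  rw [totalDt_apply, hf.evolutionary_eq_zero, add_zero]

protected theorem UIndep.partialDeriv {f : DiffFun n m} (hf : UIndep f) (z : Coord n m) :
    UIndep (partialDeriv z f) := by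
  intro k
  ext1 I
  rw [jetDeriv_apply, partialDeriv_comm, ← jetDeriv_apply, hf k]
  simp

protected theorem UIndep.antideriv {f : DiffFun n m} (hf : UIndep f) {z : Coord n m}
    (hz : ∀ k I, Coord.u k I ≠ z) : UIndep (antideriv z f) := by
  intro k
  ext1 I
  rw [jetDeriv_apply, partialDeriv_antideriv_of_ne (hz k I), ← jetDeriv_apply, hf k]
  simp [antideriv_zero]

/-- The coordinates `u^k_I`, as a set of coordinates to be scaled. -/
def isU : Coord n m → Bool
  | .u _ _ => true
  | _ => false

theorem uIndep_atZero (f : DiffFun n m) : UIndep (atZero isU f) :=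
  fun _ => Finsupp.ext fun _ => partialDeriv_atZero isU f rfl

theorem scaleAvg_totalDx (i : Fin n) (f : DiffFun n m) :
    scaleAvg isU (totalDx i f) = totalDx i (scaleAvg isU f) := by
  rw [totalDx_apply, totalDx_apply, map_add, partialDeriv_scaleAvg_of_not _ _ (by rfl),
    evolutionary_apply, evolutionary_apply, map_sum]
  congr 1
  refine Finset.sum_congr rfl fun k _ => ?_
  set S := (jetDeriv k f).support ∪ (jetDeriv k (scaleAvg isU f)).support
  rw [jetPairing_jetDeriv_eq_sum k _ f (S := S) Finset.subset_union_left,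
    jetPairing_jetDeriv_eq_sum k _ (scaleAvg isU f) (S := S) Finset.subset_union_right, map_sum]
  exact Finset.sum_congr rfl fun I _ =>
    (coord_mul_partialDeriv_scaleAvg _ _ (by rfl) (by rfl)).symm

/-- The sum `∑_I u^k_I h_I`: the differential operator encoded by `h`, applied to `u^k`. -/
abbrev uPairing (k : Fin m) : Jet n m →ₗ[DiffFun n m] DiffFun n m :=
  jetPairing fun I => coord (.u k I)

theorem sub_atZero_isU (f : DiffFun n m) :
    f - atZero isU f = ∑ k, uPairing k (entrywise (scaleAvg isU) (jetDeriv k f)) := by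
  set s : Fin m → Finset (Fin n → ℕ) := fun k => (jetDeriv k f).support
  let e : (Σ _ : Fin m, Fin n → ℕ) ↪ Coord n m :=
    ⟨fun kI => .u kI.1 kI.2, fun ⟨_, _⟩ ⟨_, _⟩ h => by cases h; rfl⟩
  have hmem (z : Coord n m) (hz : isU z) (hzS : z ∉ (Finset.univ.sigma s).map e) :
      partialDeriv z f = 0 := by
    rcases z with _ | _ | ⟨k, I⟩
    · cases hz
    · cases hz
    · by_contra h
      exact hzS (Finset.mem_map.2 ⟨⟨k, I⟩, by simpa [s] using h, rfl⟩)
  rw [sub_atZero isU f _ hmem, Finset.filter_true_of_mem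
    fun z hz => by obtain ⟨_, _, rfl⟩ := Finset.mem_map.1 hz; rfl, Finset.sum_map,
    Finset.sum_sigma]
  refine Finset.sum_congr rfl fun k _ => ?_
  rw [Finsupp.linearCombination_apply, Finsupp.sum_of_support_subset (s := s k) _ _ _ (by simp)]
  · exact Finset.sum_congr rfl fun I _ => by
      rw [entrywise_apply, jetDeriv_apply, smul_eq_mul, mul_comm]; rfl
  · exact Finsupp.support_mapRange (hf := map_zero _)

/-- One integration by parts in a direction of `A`, a shift in the other directions. -/
def byParts (A : Finset (Fin n)) (i : Fin n) : Module.End ℝ (Jet n m) :=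
  if i ∈ A then -entrywise (totalDxEnd i) else (shift i).restrictScalars ℝ

theorem byParts_of_mem {A : Finset (Fin n)} {i : Fin n} (h : i ∈ A) (e : Jet n m) :
    byParts A i e = -entrywise (totalDxEnd i) e := by
  simp [byParts, h]

theorem byParts_of_notMem {A : Finset (Fin n)} {i : Fin n} (h : i ∉ A) (e : Jet n m) :
    byParts A i e = shift i e := by
  simp [byParts, h]

theorem shift_comm (i j : Fin n) (h : Jet n m) : shift i (shift j h) = shift j (shift i h) := by
  induction h using Finsupp.induction_linear with
  | zero => simp
  | add f g hf hg => simp only [map_add, hf, hg]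
  | single K g => simp [add_right_comm]

theorem entrywise_byParts (A : Finset (Fin n)) {φ : DiffFun n m →ₗ[ℝ] DiffFun n m}
    (hφ : ∀ i f, φ (totalDx i f) = totalDx i (φ f)) (i : Fin n) (e : Jet n m) :
    entrywise φ (byParts A i e) = byParts A i (entrywise φ e) := by
  by_cases h : i ∈ A
  · rw [byParts_of_mem h, byParts_of_mem h, map_neg]
    congr 1
    ext1 K
    simp [hφ]
  · rw [byParts_of_notMem h, byParts_of_notMem h, entrywise_shift]

theorem byParts_shift (A : Finset (Fin n)) (i j : Fin n) (e : Jet n m) :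
    byParts A i (shift j e) = shift j (byParts A i e) := by
  by_cases h : i ∈ A
  · rw [byParts_of_mem h, byParts_of_mem h, map_neg, entrywise_shift]
  · rw [byParts_of_notMem h, byParts_of_notMem h, shift_comm]

theorem byParts_commute (A : Finset (Fin n)) (i j : Fin n) :
    Commute (byParts A i : Module.End ℝ (Jet n m)) (byParts A j) := by
  refine LinearMap.ext fun e => ?_
  change byParts A i (byParts A j e) = byParts A j (byParts A i e)
  by_cases h : j ∈ A
  · rw [byParts_of_mem h, byParts_of_mem h, map_neg,
      entrywise_byParts A (φ := totalDxEnd j) (totalDx_comm j)]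
  · rw [byParts_of_notMem h, byParts_of_notMem h, byParts_shift]

/-- The formal adjoint in the directions of `A` only: `K` splits as `K_A + K'` with `K_A` supported
in `A`, and `(-D_x)^{K_A} h_K` is placed at the index `K'`. -/
def partialAdjoint (A : Finset (Fin n)) : Jet n m →ₗ[ℝ] Jet n m :=
  assemble (byParts A) (Finsupp.lsingle 0)

theorem partialAdjoint_shift (A : Finset (Fin n)) (i : Fin n) (h : Jet n m) :
    partialAdjoint A (shift i h) = byParts A i (partialAdjoint A h) :=
  assemble_shift (byParts_commute A) _ i h

theorem partialAdjoint_entrywise (A : Finset (Fin n)) {φ : DiffFun n m →ₗ[ℝ] DiffFun n m}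
    (hφ : ∀ i f, φ (totalDx i f) = totalDx i (φ f)) (h : Jet n m) :
    partialAdjoint A (entrywise φ h) = entrywise φ (partialAdjoint A h) :=
  assemble_entrywise (fun g => by simp) (entrywise_byParts A hφ) h

theorem partialAdjoint_univ (h : Jet n m) :
    partialAdjoint Finset.univ h = Finsupp.single 0 (jetAdjoint h) := by
  induction h using Finsupp.induction_linear with
  | zero => simp
  | add f g hf hg => simp only [map_add, hf, hg, Finsupp.single_add]
  | single K g =>
    rw [partialAdjoint, assemble_single, jetAdjoint, assemble_single]
    exact (map_endMonomial (T := fun i => -totalDxEnd i) (T' := byParts Finset.univ)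
      (Finsupp.lsingle (R := ℝ) 0)
      (fun i x => by rw [byParts_of_mem (Finset.mem_univ i)]; simp) K g).symm

/-- The space of all sums `∑_{i ∈ A} D_{x_i} P_i`. -/
def divergences (A : Finset (Fin n)) : Submodule ℝ (DiffFun n m) :=
  LinearMap.range (∑ i ∈ A, totalDxEnd i ∘ₗ LinearMap.proj (R := ℝ) (φ := fun _ => DiffFun n m) i)

theorem mem_divergences {A : Finset (Fin n)} {f : DiffFun n m} :
    f ∈ divergences A ↔ ∃ P : Fin n → DiffFun n m, ∑ i ∈ A, totalDx i (P i) = f := by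
  simp [divergences, LinearMap.mem_range, LinearMap.sum_apply]

theorem totalDx_mem_divergences {A : Finset (Fin n)} {i : Fin n} (h : i ∈ A) (f : DiffFun n m) :
    totalDx i f ∈ divergences A := by
  refine mem_divergences.2 ⟨Pi.single i f, ?_⟩
  rw [Finset.sum_eq_single_of_mem i h, Pi.single_eq_same]
  intro j _ hj
  rw [Pi.single_eq_of_ne hj, map_zero]

theorem uPairing_byParts_sub_mem_divergences (A : Finset (Fin n)) (k : Fin m) (i : Fin n)
    (e : Jet n m) : uPairing k (byParts A i e) - uPairing k (shift i e) ∈ divergences A := by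
  by_cases h : i ∈ A
  · have hparts : uPairing k (byParts A i e) - uPairing k (shift i e) =
        -totalDx i (uPairing k e) := by
      rw [byParts_of_mem h, derivation_jetPairing, jetPairing_shift, map_neg]
      simp only [totalDx_coord]
      ring
    rw [hparts]
    exact (divergences A).neg_mem (totalDx_mem_divergences h _)
  · rw [byParts_of_notMem h, sub_self]
    exact (divergences A).zero_mem

theorem uPairing_endMonomial_byParts_sub_mem_divergences (A : Finset (Fin n)) (k : Fin m)
    (K J : Fin n → ℕ) (g : DiffFun n m) :
    uPairing k (endMonomial (byParts A) K (Finsupp.single J g)) -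
      uPairing k (Finsupp.single (J + K) g) ∈ divergences A := by
  induction K using multiIndex_induction generalizing J with
  | zero => simp
  | add_single K i ih =>
    have hshift : endMonomial (byParts A) K (Finsupp.single (J + Pi.single i 1) g) =
        shift i (endMonomial (byParts A) K (Finsupp.single J g)) := by
      rw [← shift_single]
      exact (map_endMonomial (T := byParts A) ((shift i).restrictScalars ℝ)
        (fun j x => (byParts_shift A j i x).symm) K _).symm
    have hsum := (divergences A).add_mem
      (uPairing_byParts_sub_mem_divergences A k i (endMonomial (byParts A) K (Finsupp.single J g)))
      (ih (J + Pi.single i 1))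
    rw [hshift, sub_add_sub_cancel, add_assoc, add_comm (Pi.single i 1)] at hsum
    rwa [endMonomial_add_single (byParts_commute A)]

theorem uPairing_sub_uPairing_partialAdjoint_mem_divergences (A : Finset (Fin n)) (k : Fin m)
    (h : Jet n m) : uPairing k h - uPairing k (partialAdjoint A h) ∈ divergences A := by
  induction h using Finsupp.induction_linear with
  | zero => simp
  | add f g hf hg =>
    have := (divergences A).add_mem hf hg
    rwa [← add_sub_add_comm, ← map_add, ← map_add, ← map_add] at this
  | single K g =>
    have := (divergences A).neg_mem (uPairing_endMonomial_byParts_sub_mem_divergences A k K 0 g)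
    rw [neg_sub, zero_add] at this
    rwa [partialAdjoint, assemble_single]

theorem sub_atZero_mem_divergences {A : Finset (Fin n)} {f : DiffFun n m}
    (h : ∀ k, partialAdjoint A (jetDeriv k f) = 0) : f - atZero isU f ∈ divergences A := by
  rw [sub_atZero_isU]
  refine (divergences A).sum_mem fun k _ => ?_
  have := uPairing_sub_uPairing_partialAdjoint_mem_divergences A k
    (entrywise (scaleAvg isU) (jetDeriv k f))
  rwa [partialAdjoint_entrywise A scaleAvg_totalDx, h k, map_zero, map_zero, sub_zero] at this

theorem partialAdjoint_jetDeriv_totalDx (A : Finset (Fin n)) (k : Fin m) (i : Fin n)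
    (f : DiffFun n m) : partialAdjoint A (jetDeriv k (totalDx i f)) =
      entrywise (totalDxEnd i) (partialAdjoint A (jetDeriv k f)) +
        byParts A i (partialAdjoint A (jetDeriv k f)) := by
  rw [jetDeriv_totalDx, map_add, partialAdjoint_shift,
    partialAdjoint_entrywise A (φ := totalDxEnd i) (totalDx_comm i)]

theorem partialAdjoint_jetDeriv_of_mem_divergences {A : Finset (Fin n)} {f : DiffFun n m}
    (hf : f ∈ divergences A) (k : Fin m) : partialAdjoint A (jetDeriv k f) = 0 := by
  obtain ⟨P, rfl⟩ := mem_divergences.1 hf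
  rw [map_sum, map_sum]
  refine Finset.sum_eq_zero fun i hi => ?_
  rw [partialAdjoint_jetDeriv_totalDx, byParts_of_mem hi]
  exact add_neg_cancel _

theorem eq_zero_of_entrywise_totalDx_add_shift {i : Fin n} {e : Jet n m}
    (he : entrywise (totalDxEnd i) e + shift i e = 0) : e = 0 := by
  have hstep (K : Fin n → ℕ) (hK : e (K + Pi.single i 1) = 0) : e K = 0 := by
    have := DFunLike.congr_fun he (K + Pi.single i 1)
    rw [Finsupp.add_apply, shift_apply_add, entrywise_apply, hK] at this
    simpa using this
  have hdescend (N : ℕ) (K : Fin n → ℕ) (hK : e (K + Pi.single i N) = 0) : e K = 0 := by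
    induction N generalizing K with
    | zero => simpa using hK
    | succ N ih =>
      refine ih K (hstep _ ?_)
      rwa [add_assoc, ← Pi.single_add]
  ext1 K
  obtain ⟨_, ⟨N, rfl⟩, hN⟩ := Set.Infinite.exists_notMem_finset
    (Set.infinite_range_of_injective (f := fun N : ℕ => K + Pi.single i N)
      ((add_right_injective K).comp (Pi.single_injective (M := fun _ => ℕ) i))) e.support
  exact hdescend N K (Finsupp.notMem_support_iff.1 hN)

theorem partialAdjoint_jetDeriv_of_totalDx_mem_divergences {A : Finset (Fin n)} {i : Fin n}
    (hi : i ∉ A) {f : DiffFun n m} (hf : totalDx i f ∈ divergences A) (k : Fin m) :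
    partialAdjoint A (jetDeriv k f) = 0 := by
  have := partialAdjoint_jetDeriv_of_mem_divergences hf k
  rw [partialAdjoint_jetDeriv_totalDx, byParts_of_notMem hi] at this
  exact eq_zero_of_entrywise_totalDx_add_shift this

theorem UIndep.mem_divergences {f : DiffFun n m} (hf : UIndep f) {A : Finset (Fin n)}
    (hA : A.Nonempty) : f ∈ divergences A := by
  obtain ⟨i, hi⟩ := hA
  have := totalDx_mem_divergences hi (Brusselator.antideriv (.x i) f)
  rwa [(hf.antideriv (z := .x i) (by simp)).totalDx_eq, partialDeriv_antideriv_self] at this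

theorem mem_divergences_of_totalDx_mem {A : Finset (Fin n)} (hA : A.Nonempty) {i : Fin n}
    (hi : i ∉ A) {f : DiffFun n m} (hf : totalDx i f ∈ divergences A) : f ∈ divergences A := by
  have hsub : f - atZero isU f ∈ divergences A :=
    sub_atZero_mem_divergences (partialAdjoint_jetDeriv_of_totalDx_mem_divergences hi hf)
  simpa using (divergences A).add_mem hsub ((uIndep_atZero f).mem_divergences hA)

theorem mem_divergences_univ_of_eulerOp_eq_zero [NeZero n] {f : DiffFun n m}
    (hf : ∀ k, eulerOp k f = 0) : f ∈ divergences Finset.univ := by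
  have hsub : f - atZero isU f ∈ divergences Finset.univ :=
    sub_atZero_mem_divergences fun k => by
      rw [partialAdjoint_univ, ← eulerOp_apply, hf k, Finsupp.single_zero]
  simpa using (divergences _).add_mem hsub
    ((uIndep_atZero f).mem_divergences Finset.univ_nonempty)

/-- The components `J i`, `i ∈ A`, form a trivial current in the space directions of `A` whose
density is zero: `Q` holds the potentials `L_{0i}` and the antisymmetric matrix `L` the others. -/
def HasPotentialOn (F : Fin m → DiffFun n m) (A : Finset (Fin n)) (J : Fin n → DiffFun n m) :
    Prop :=
  ∃ (L : Fin n → Fin n → DiffFun n m) (Q : Fin n → DiffFun n m), (∀ i j, L i j = -L j i) ∧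
    ∑ i ∈ A, totalDx i (Q i) = 0 ∧
    ∀ i ∈ A, J i = totalDt F (Q i) + ∑ l ∈ A, totalDx l (L l i)

theorem hasPotentialOn_singleton (F : Fin m → DiffFun n m) {i : Fin n} {J : Fin n → DiffFun n m}
    (h : totalDx i (J i) = 0) : HasPotentialOn F {i} J := by
  have hmem : J i - atZero isU (J i) ∈ divergences ∅ :=
    sub_atZero_mem_divergences (partialAdjoint_jetDeriv_of_totalDx_mem_divergences
      (Finset.notMem_empty i) (h ▸ (divergences ∅).zero_mem))
  obtain ⟨P, hP⟩ := mem_divergences.1 hmem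
  rw [Finset.sum_empty, eq_comm, sub_eq_zero] at hP
  have hu : UIndep (J i) := hP ▸ uIndep_atZero (J i)
  have hQ : UIndep (antideriv .t (J i)) := hu.antideriv (by simp)
  refine ⟨0, fun _ => antideriv .t (J i), by simp, ?_, ?_⟩
  · rw [Finset.sum_singleton, hQ.totalDx_eq, partialDeriv_antideriv_of_ne (by simp),
      ← hu.totalDx_eq, h, antideriv_zero]
  · intro j hj
    rw [Finset.mem_singleton.1 hj, hQ.totalDt_eq, partialDeriv_antideriv_self]
    simp

theorem HasPotentialOn.cons {F : Fin m → DiffFun n m} {A : Finset (Fin n)} {i : Fin n}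
    {J P : Fin n → DiffFun n m} (hi : i ∉ A) (hP : ∑ l ∈ A, totalDx l (P l) = J i)
    (h : HasPotentialOn F A fun l => J l + totalDx i (P l)) :
    HasPotentialOn F (A.cons i hi) J := by
  obtain ⟨L, Q, hL, hQ, hJ⟩ := h
  have hne {l : Fin n} (hl : l ∈ A) : l ≠ i := fun e => hi (e ▸ hl)
  have hsum {f g : Fin n → DiffFun n m} :
      ∑ l ∈ A, totalDx l (if l = i then f l else g l) = ∑ l ∈ A, totalDx l (g l) :=
    Finset.sum_congr rfl fun l hl => by rw [if_neg (hne hl)]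
  refine ⟨fun a b => if a = i then (if b = i then 0 else -P b) else if b = i then P a else L a b,
    fun j => if j = i then 0 else Q j, fun a b => ?_, ?_, fun j hj => ?_⟩
  · by_cases ha : a = i <;> by_cases hb : b = i <;> simp only [ha, hb, if_true, if_false, neg_neg,
      neg_zero]
    exact hL a b
  · simp only [Finset.sum_cons, if_true, map_zero, zero_add, hsum, hQ]
  · rw [Finset.sum_cons, hsum]
    rcases Finset.mem_cons.1 hj with rfl | hj
    · simp only [if_true, map_zero, zero_add, hP]
    · simp only [if_true, if_neg (hne hj), map_neg]
      rw [add_left_comm, ← hJ j hj]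
      ring

theorem hasPotentialOn_of_divergence_free (F : Fin m → DiffFun n m) {A : Finset (Fin n)}
    (hA : A.Nonempty) {J : Fin n → DiffFun n m} (h : ∑ i ∈ A, totalDx i (J i) = 0) :
    HasPotentialOn F A J := by
  induction hA using Finset.Nonempty.cons_induction generalizing J with
  | singleton i => exact hasPotentialOn_singleton F (by rwa [Finset.sum_singleton] at h)
  | cons i A hi hA ih =>
    rw [Finset.sum_cons] at h
    have hDJ : totalDx i (J i) ∈ divergences A := by
      rw [eq_neg_of_add_eq_zero_left h]
      exact (divergences A).neg_mem (mem_divergences.2 ⟨J, rfl⟩)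
    obtain ⟨P, hP⟩ := mem_divergences.1 (mem_divergences_of_totalDx_mem hA hi hDJ)
    refine HasPotentialOn.cons hi hP (ih ?_)
    simp only [map_add, Finset.sum_add_distrib]
    rw [← h, ← hP, map_sum, add_comm]
    exact congrArg (· + _) (Finset.sum_congr rfl fun l _ => totalDx_comm l i _)

theorem sum_totalDx_eq_sum_Iio_sub_sum_Ioi {L : Fin n → Fin n → DiffFun n m}
    (hL : ∀ i j, L i j = -L j i) (i : Fin n) : ∑ l, totalDx l (L l i) =
      ∑ l ∈ Finset.Iio i, totalDx l (L l i) - ∑ l ∈ Finset.Ioi i, totalDx l (L i l) := by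
  have hdiag : L i i = 0 := DiffFun.ext fun p => by
    have := DFunLike.congr_fun (hL i i) p
    rw [DiffFun.neg_apply] at this
    rw [DiffFun.zero_apply]
    linarith
  have herase : (Finset.univ : Finset (Fin n)).erase i = Finset.Iio i ∪ Finset.Ioi i := by
    ext l
    simp [lt_or_lt_iff_ne]
  have hdisj : Disjoint (Finset.Iio i) (Finset.Ioi i) := Finset.disjoint_left.2 fun l h h' =>
    (Finset.mem_Iio.1 h).asymm (Finset.mem_Ioi.1 h')
  rw [← Finset.add_sum_erase _ _ (Finset.mem_univ i), hdiag, map_zero, zero_add, herase,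
    Finset.sum_union hdisj, sub_eq_add_neg, ← Finset.sum_neg_distrib]
  exact congrArg (_ + ·) (Finset.sum_congr rfl fun l _ => by rw [hL l i, map_neg])

theorem exists_potential_of_eulerOp_eq_zero [NeZero n] (F : Fin m → DiffFun n m)
    {J₀ : DiffFun n m} {J : Fin n → DiffFun n m} (hJ : totalDt F J₀ + ∑ i, totalDx i (J i) = 0)
    (he : ∀ k, eulerOp k J₀ = 0) :
    ∃ (P : Fin n → DiffFun n m) (L : Fin n → Fin n → DiffFun n m),
      J₀ = -∑ i, totalDx i (P i) ∧ ∀ i, J i = totalDt F (P i) +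
        (∑ l ∈ Finset.Iio i, totalDx l (L l i) - ∑ l ∈ Finset.Ioi i, totalDx l (L i l)) := by
  obtain ⟨P, hP⟩ := mem_divergences.1 (mem_divergences_univ_of_eulerOp_eq_zero he)
  have hfree : ∑ i, totalDx i (J i + totalDt F (P i)) = 0 := by
    simp only [map_add, Finset.sum_add_distrib]
    rw [← hJ, ← hP, map_sum, add_comm]
    exact congrArg (· + _) (Finset.sum_congr rfl fun l _ => totalDx_totalDt_comm F l _)
  obtain ⟨L, Q, hL, hQ, hJ'⟩ := hasPotentialOn_of_divergence_free F Finset.univ_nonempty hfree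
  refine ⟨Q - P, L, ?_, fun i => ?_⟩
  · simp only [Pi.sub_apply, map_sub, Finset.sum_sub_distrib, hQ, hP]
    ring
  · rw [← sum_totalDx_eq_sum_Iio_sub_sum_Ioi hL, Pi.sub_apply, map_sub]
    linear_combination hJ' i (Finset.mem_univ i)

theorem sum_add_single (K : Fin n → ℕ) (i : Fin n) :
    ∑ j, (K + Pi.single i 1 : Fin n → ℕ) j = ∑ j, K j + 1 := by
  simp [Finset.sum_add_distrib]

theorem eq_zero_or_exists_add_single (K : Fin n → ℕ) (i : Fin n) :
    K i = 0 ∨ ∃ K' : Fin n → ℕ, K = K' + Pi.single i 1 := by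
  refine (Nat.eq_zero_or_pos (K i)).imp_right fun hi => ⟨K - Pi.single i 1, ?_⟩
  exact (tsub_add_cancel_of_le (update_le_iff.2 ⟨hi, fun _ _ => Nat.zero_le _⟩)).symm

theorem shift_eq_zero_or (i : Fin n) (h : Jet n m) (K : Fin n → ℕ) :
    shift i h K = 0 ∨ ∃ K' : Fin n → ℕ, K = K' + Pi.single i 1 ∧ shift i h K = h K' := by
  rcases eq_zero_or_exists_add_single K i with hK | ⟨K', rfl⟩
  · exact Or.inl (shift_apply_of_eq_zero h hK)
  · exact Or.inr ⟨K', rfl, shift_apply_add i h K'⟩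

variable (n m) in
/-- The subalgebra of the differential functions that do not depend on the derivatives `u^k_K` of
order `|K| ≥ r`. -/
def ordLT (r : ℕ) : Subalgebra ℝ (DiffFun n m) where
  carrier := {f | ∀ k (K : Fin n → ℕ), r ≤ ∑ i, K i → partialDeriv (.u k K) f = 0}
  add_mem' hf hg k K hK := by rw [map_add, hf k K hK, hg k K hK, add_zero]
  mul_mem' hf hg k K hK := by
    rw [Derivation.leibniz, hf k K hK, hg k K hK, smul_zero, smul_zero, add_zero]
  algebraMap_mem' c _ _ _ := Derivation.map_algebraMap _ c

section OrdLT

variable {r s : ℕ} {f : DiffFun n m}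

theorem ordLT_mono (h : r ≤ s) : ordLT n m r ≤ ordLT n m s :=
  fun _ hf k K hK => hf k K (h.trans hK)

theorem mem_ordLT_zero : f ∈ ordLT n m 0 ↔ UIndep f :=
  ⟨fun h k => Finsupp.ext fun K => h k K (Nat.zero_le _),
    fun h k K _ => by rw [← jetDeriv_apply, h k, Finsupp.zero_apply]⟩

theorem UIndep.mem_ordLT (hf : UIndep f) (r : ℕ) : f ∈ ordLT n m r :=
  ordLT_mono (Nat.zero_le r) (mem_ordLT_zero.2 hf)

theorem UIndep.partialDeriv_u_eq_zero (hf : UIndep f) (k : Fin m) (K : Fin n → ℕ) :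
    partialDeriv (.u k K) f = 0 := mem_ordLT_zero.2 hf k K (Nat.zero_le _)

theorem coord_mem_ordLT_one (k : Fin m) : coord (.u k 0) ∈ ordLT n m 1 := fun j K hK => by
  rw [partialDeriv_coord, if_neg]
  rintro ⟨⟩
  simp at hK

theorem partialDeriv_mem_ordLT (hf : f ∈ ordLT n m r) (z : Coord n m) :
    partialDeriv z f ∈ ordLT n m r := fun k K hK => by
  rw [partialDeriv_comm, hf k K hK, map_zero]

theorem totalDx_mem_ordLT (hf : f ∈ ordLT n m r) (i : Fin n) :
    totalDx i f ∈ ordLT n m (r + 1) := fun k K hK => by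
  rcases eq_zero_or_exists_add_single K i with h | ⟨K', rfl⟩
  · rw [partialDeriv_totalDx_of_eq_zero k h, hf k K (by omega), map_zero]
  · rw [sum_add_single] at hK
    rw [partialDeriv_totalDx_add, hf k K' (by omega), hf k _ (by rw [sum_add_single]; omega),
      map_zero, add_zero]

theorem totalDxI_mem_ordLT (hf : f ∈ ordLT n m r) (J : Fin n → ℕ) :
    totalDxI J f ∈ ordLT n m (r + ∑ i, J i) := by
  induction J using multiIndex_induction with
  | zero => simpa using hf
  | add_single J i ih =>
    rw [totalDxI_add_single, sum_add_single]
    exact totalDx_mem_ordLT ih i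

theorem exists_mem_ordLT (f : DiffFun n m) : ∃ r, f ∈ ordLT n m r := by
  refine ⟨∑ k, ∑ K ∈ (jetDeriv k f).support, (∑ i, K i + 1), fun k K hK => ?_⟩
  by_contra h
  have hle : ∑ i, K i + 1 ≤ ∑ K ∈ (jetDeriv k f).support, (∑ i, K i + 1) :=
    Finset.single_le_sum (f := fun K : Fin n → ℕ => ∑ i, K i + 1) (fun _ _ => Nat.zero_le _)
      (Finsupp.mem_support_iff.2 h)
  have hle' : ∑ K ∈ (jetDeriv k f).support, (∑ i, K i + 1) ≤
      ∑ k, ∑ K ∈ (jetDeriv k f).support, (∑ i, K i + 1) :=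
    Finset.single_le_sum (f := fun k => ∑ K ∈ (jetDeriv k f).support, (∑ i, K i + 1))
      (fun _ _ => Nat.zero_le _) (Finset.mem_univ k)
  omega

theorem partialDeriv_totalDxI_top (hf : f ∈ ordLT n m 1) (k : Fin m) (J K : Fin n → ℕ)
    (hK : ∑ i, K i = ∑ i, J i) :
    partialDeriv (.u k K) (totalDxI J f) = if J = K then partialDeriv (.u k 0) f else 0 := by
  induction J using multiIndex_induction generalizing K with
  | zero =>
    obtain rfl : K = 0 := funext fun i =>
      Finset.sum_eq_zero_iff.1 (hK.trans (by simp)) i (Finset.mem_univ i)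
    simp
  | add_single J i ih =>
    rw [sum_add_single] at hK
    have hlow : partialDeriv (.u k K) (totalDxI J f) = 0 :=
      totalDxI_mem_ordLT hf J k K (by omega)
    rw [totalDxI_add_single]
    rcases eq_zero_or_exists_add_single K i with h | ⟨K', rfl⟩
    · rw [partialDeriv_totalDx_of_eq_zero k h, hlow, map_zero, if_neg]
      rintro rfl
      simp at h
    · rw [sum_add_single] at hK
      rw [partialDeriv_totalDx_add, hlow, map_zero, zero_add, ih K' (by omega)]
      simp

end OrdLT

theorem jetPairing_congr {a a' : (Fin n → ℕ) → DiffFun n m} {h : Jet n m}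
    (ha : ∀ I, h I ≠ 0 → a I = a' I) : jetPairing a h = jetPairing a' h := by
  rw [Finsupp.linearCombination_apply, Finsupp.linearCombination_apply]
  exact Finsupp.sum_congr fun I hI => by rw [ha I (Finsupp.mem_support_iff.1 hI)]

theorem jetPairing_ite_eq (a : DiffFun n m) (K : Fin n → ℕ) (h : Jet n m) :
    jetPairing (fun J => if J = K then a else 0) h = a * h K := by
  induction h using Finsupp.induction_linear with
  | zero => simp
  | add f g hf hg => rw [map_add, hf, hg, Finsupp.add_apply, mul_add]
  | single J h =>
    by_cases hJ : J = K
    · simp [hJ, mul_comm]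
    · simp [hJ]

/-- The total Laplacian `∑_i D_{x_i}^2`. -/
def lap : DiffFun n m →ₗ[ℝ] DiffFun n m := ∑ i, totalDxEnd i ∘ₗ totalDxEnd i

theorem lap_apply (f : DiffFun n m) : lap f = ∑ i, totalDx i (totalDx i f) := by
  simp [lap, LinearMap.sum_apply]

protected theorem UIndep.lap {f : DiffFun n m} (hf : UIndep f) : UIndep (lap f) := by
  rw [lap_apply, ← mem_ordLT_zero]
  refine sum_mem fun i _ => ?_
  rw [hf.totalDx_eq, (hf.partialDeriv _).totalDx_eq, mem_ordLT_zero]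
  exact (hf.partialDeriv _).partialDeriv _

theorem partialDeriv_lap (k : Fin m) (K : Fin n → ℕ) (f : DiffFun n m) :
    partialDeriv (.u k K) (lap f) = lap (partialDeriv (.u k K) f) +
      2 * ∑ i, totalDx i (shift i (jetDeriv k f) K) +
      ∑ i, shift i (shift i (jetDeriv k f)) K := by
  rw [lap_apply, lap_apply, map_sum, Finset.mul_sum, ← Finset.sum_add_distrib,
    ← Finset.sum_add_distrib]
  refine Finset.sum_congr rfl fun i _ => ?_
  rw [← jetDeriv_apply, jetDeriv_totalDx, jetDeriv_totalDx, map_add, map_add, ← entrywise_shift]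
  simp only [Finsupp.add_apply, entrywise_apply, jetDeriv_apply, Derivation.coeFn_coe]
  ring

theorem partialDeriv_totalDt (F : Fin m → DiffFun n m) (k : Fin m) (K : Fin n → ℕ)
    (f : DiffFun n m) :
    partialDeriv (.u k K) (totalDt F f) = totalDt F (partialDeriv (.u k K) f) +
      ∑ j, jetPairing (fun J => partialDeriv (.u k K) (totalDxI J (F j))) (jetDeriv j f) := by
  rw [totalDt_apply, totalDt_apply, map_add, partialDeriv_evolutionary, partialDeriv_comm _ .t,
    add_assoc]

theorem totalDxI_coord (k : Fin m) (J K : Fin n → ℕ) :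
    totalDxI J (coord (.u k K) : DiffFun n m) = coord (.u k (K + J)) := by
  induction J using multiIndex_induction with
  | zero => simp
  | add_single J i ih => rw [totalDxI_add_single, ih, totalDx_coord, add_assoc]

theorem totalDxI_lap_coord (k : Fin m) (J : Fin n → ℕ) :
    totalDxI J (lap (coord (.u k 0)) : DiffFun n m) =
      ∑ i, coord (.u k (J + Pi.single i 1 + Pi.single i 1)) := by
  rw [lap_apply, map_sum]
  refine Finset.sum_congr rfl fun i _ => ?_
  rw [totalDx_coord, totalDx_coord, totalDxI_coord, zero_add, add_comm, add_assoc]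

theorem jetPairing_partialDeriv_lap_coord (j k : Fin m) (K : Fin n → ℕ) (h : Jet n m) :
    jetPairing (fun J => partialDeriv (.u k K) (totalDxI J (lap (coord (.u j 0))))) h =
      if k = j then ∑ i, shift i (shift i h) K else 0 := by
  simp only [totalDxI_lap_coord, map_sum, partialDeriv_coord]
  induction h using Finsupp.induction_linear with
  | zero => simp
  | add f g hf hg =>
    rw [map_add, hf, hg]
    split_ifs
    · simp only [map_add, Finsupp.add_apply, Finset.sum_add_distrib]
    · rw [add_zero]
  | single J g =>
    by_cases hk : k = j
    · simp [hk, Finsupp.single_apply, eq_comm (a := K), Finset.sum_ite, mul_comm]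
    · simp [hk]

/-- The right-hand sides `F^k = d_k Δu^k + g_k` of a reaction–diffusion system. -/
def reactionDiffusion (d : Fin m → ℝ) (g : Fin m → DiffFun n m) (k : Fin m) : DiffFun n m :=
  d k • lap (coord (.u k 0)) + g k

theorem partialDeriv_totalDt_reactionDiffusion (d : Fin m → ℝ) (g : Fin m → DiffFun n m)
    (k : Fin m) (K : Fin n → ℕ) (f : DiffFun n m) :
    partialDeriv (.u k K) (totalDt (reactionDiffusion d g) f) =
      totalDt (reactionDiffusion d g) (partialDeriv (.u k K) f) +
      d k • ∑ i, shift i (shift i (jetDeriv k f)) K +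
      ∑ j, jetPairing (fun J => partialDeriv (.u k K) (totalDxI J (g j))) (jetDeriv j f) := by
  have hsplit (j : Fin m) (h : Jet n m) :
      jetPairing (fun J => partialDeriv (.u k K) (totalDxI J (reactionDiffusion d g j))) h =
        d j • (if k = j then ∑ i, shift i (shift i h) K else 0) +
          jetPairing (fun J => partialDeriv (.u k K) (totalDxI J (g j))) h := by
    rw [← jetPairing_partialDeriv_lap_coord]
    simp only [reactionDiffusion, map_add, map_smul, Derivation.map_smul]
    induction h using Finsupp.induction_linear with
    | zero => simp
    | add f g hf hg => simp only [map_add, smul_add, hf, hg]; ring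
    | single J h => simp [mul_add]
  simp only [partialDeriv_totalDt, hsplit, Finset.sum_add_distrib, smul_ite, smul_zero,
    Finset.sum_ite_eq, Finset.mem_univ, if_true, add_assoc]

section TopOrder

variable [NeZero n] {r s : ℕ} {h : Jet n m}

theorem eq_zero_of_sum_shift_shift
    (hh : ∀ K : Fin n → ℕ, ∑ i, K i = r + 2 → ∑ i, shift i (shift i h) K = 0)
    (J : Fin n → ℕ) (hJ : ∑ i, J i = r) : h J = 0 := by
  induction hN : r - J 0 using Nat.strong_induction_on generalizing J with
  | _ N ih =>
    have hsum := hh (J + Pi.single 0 1 + Pi.single 0 1) (by rw [sum_add_single, sum_add_single, hJ])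
    rwa [Finset.sum_eq_single 0 ?_ (by simp), shift_apply_add, shift_apply_add] at hsum
    intro i _ hi
    rcases shift_eq_zero_or i (shift i h) (J + Pi.single 0 1 + Pi.single 0 1) with
      h₁ | ⟨K', hK', h₁⟩
    · exact h₁
    rw [h₁]
    rcases shift_eq_zero_or i h K' with h₂ | ⟨K, rfl, h₂⟩
    · exact h₂
    rw [h₂]
    have hK := congrArg (fun K : Fin n → ℕ => ∑ j, K j) hK'
    simp only [sum_add_single] at hK
    have hK₀ : J 0 + 1 + 1 = K 0 := by simpa [hi.symm] using congrFun hK' 0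
    have hle : K 0 ≤ ∑ j, K j :=
      Finset.single_le_sum (fun _ _ => Nat.zero_le _) (Finset.mem_univ 0)
    exact ih (r - K 0) (by omega) K (by omega) rfl

theorem mem_ordLT_of_sum_totalDx_shift
    (hh : ∀ K : Fin n → ℕ, ∑ i, K i = r + 1 →
      ∑ i, totalDx i (shift i h K) ∈ ordLT n m (s + 1))
    (hs : ∀ J : Fin n → ℕ, ∑ i, J i = r → h J ∈ ordLT n m (s + 1))
    (J : Fin n → ℕ) (hJ : ∑ i, J i = r) : h J ∈ ordLT n m s := by
  intro k L hL
  rcases hL.lt_or_eq with hL | hL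
  · exact hs J hJ k L hL
  induction hN : r - J 0 using Nat.strong_induction_on generalizing J L with
  | _ N ih =>
    have hsum := hh (J + Pi.single 0 1) (by rw [sum_add_single, hJ]) k (L + Pi.single 0 1)
      (by rw [sum_add_single]; omega)
    rwa [map_sum, Finset.sum_eq_single 0 ?_ (by simp), shift_apply_add, partialDeriv_totalDx_add,
      hs J hJ k _ (by rw [sum_add_single]; omega), map_zero, zero_add] at hsum
    intro i _ hi
    rcases shift_eq_zero_or i h (J + Pi.single 0 1) with h₁ | ⟨K, hJK, h₁⟩
    · rw [h₁, map_zero, map_zero]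
    have hK := congrArg (fun K : Fin n → ℕ => ∑ j, K j) hJK
    simp only [sum_add_single] at hK
    have hK₀ : J 0 + 1 = K 0 := by simpa [hi.symm] using congrFun hJK 0
    have hle : K 0 ≤ ∑ j, K j :=
      Finset.single_le_sum (fun _ _ => Nat.zero_le _) (Finset.mem_univ 0)
    have htop := hs K (by omega) k (L + Pi.single 0 1) (by rw [sum_add_single]; omega)
    rw [h₁]
    rcases eq_zero_or_exists_add_single (L + Pi.single 0 1) i with hLi | ⟨L', hL'⟩
    · rw [partialDeriv_totalDx_of_eq_zero k hLi, htop, map_zero]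
    · rw [hL'] at htop ⊢
      have hsumL := congrArg (fun K : Fin n → ℕ => ∑ j, K j) hL'
      simp only [sum_add_single] at hsumL
      rw [partialDeriv_totalDx_add, htop, map_zero, zero_add]
      exact ih (r - K 0) (by omega) K (by omega) L' (by omega) (by omega) rfl

theorem uIndep_of_sum_totalDx_shift
    (hh : ∀ K : Fin n → ℕ, ∑ i, K i = r + 1 → ∑ i, totalDx i (shift i h K) ∈ ordLT n m 1)
    (J : Fin n → ℕ) (hJ : ∑ i, J i = r) : UIndep (h J) := by
  have descend (s : ℕ) (hs : ∀ J : Fin n → ℕ, ∑ i, J i = r → h J ∈ ordLT n m s)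
      (J : Fin n → ℕ) (hJ : ∑ i, J i = r) : UIndep (h J) := by
    induction s generalizing J with
    | zero => exact mem_ordLT_zero.1 (hs J hJ)
    | succ s ih =>
      exact ih (mem_ordLT_of_sum_totalDx_shift
        (fun K hK => ordLT_mono (Nat.le_add_left 1 s) (hh K hK)) hs) J hJ
  choose ρ hρ using fun J => exists_mem_ordLT (h J)
  refine descend (∑ J ∈ h.support, ρ J) (fun J _ => ?_) J hJ
  by_cases h₀ : h J = 0
  · rw [h₀]
    exact zero_mem _
  · exact ordLT_mono (Finset.single_le_sum (f := ρ) (fun _ _ => Nat.zero_le _)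
      (Finsupp.mem_support_iff.2 h₀)) (hρ J)

theorem uIndep_sum_totalDx_shift
    (hh : ∀ K : Fin n → ℕ, ∑ i, K i = r → ∑ i, totalDx i (shift i h K) ∈ ordLT n m 1)
    (K : Fin n → ℕ) (hK : ∑ i, K i = r) : UIndep (∑ i, totalDx i (shift i h K)) := by
  rw [← mem_ordLT_zero]
  refine sum_mem fun i _ => ?_
  rcases shift_eq_zero_or i h K with h₁ | ⟨K', rfl, h₁⟩
  · rw [h₁, map_zero]
    exact zero_mem _
  · have hK' : UIndep (h K') := by
      refine uIndep_of_sum_totalDx_shift (r := ∑ j, K' j) (fun L hL => hh L ?_) K' rfl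
      rw [hL, ← hK, sum_add_single]
    rw [h₁, hK'.totalDx_eq]
    exact (hK'.partialDeriv _).mem_ordLT 0

end TopOrder

section EvolutionEquation

variable {d : Fin m → ℝ} {g : Fin m → DiffFun n m} {r : ℕ} {f R : DiffFun n m} {κ : ℝ}

theorem sum_jetPairing_reaction_of_lt (hg : ∀ j, g j ∈ ordLT n m 1) (hf : f ∈ ordLT n m (r + 1))
    (k : Fin m) {K : Fin n → ℕ} (hK : r < ∑ i, K i) :
    ∑ j, jetPairing (fun J => partialDeriv (.u k K) (totalDxI J (g j))) (jetDeriv j f) = 0 := by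
  refine Finset.sum_eq_zero fun j _ => ?_
  rw [jetPairing_congr (a' := fun _ => 0)]
  · simp [Finsupp.linearCombination_apply]
  · intro J hJ
    refine totalDxI_mem_ordLT (hg j) J k K ?_
    by_contra h
    exact hJ (hf j J (by omega))

theorem sum_jetPairing_reaction_of_eq (hg : ∀ j, g j ∈ ordLT n m 1) (hf : f ∈ ordLT n m (r + 1))
    (k : Fin m) {K : Fin n → ℕ} (hK : ∑ i, K i = r) :
    ∑ j, jetPairing (fun J => partialDeriv (.u k K) (totalDxI J (g j))) (jetDeriv j f) =
      ∑ j, partialDeriv (.u k 0) (g j) * partialDeriv (.u j K) f := by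
  refine Finset.sum_congr rfl fun j _ => ?_
  rw [jetPairing_congr (a' := fun J => if J = K then partialDeriv (.u k 0) (g j) else 0)]
  · rw [jetPairing_ite_eq, jetDeriv_apply]
  · intro J hJ
    have hJr : ∑ i, J i ≤ r := by
      by_contra h
      exact hJ (hf j J (by omega))
    rcases hJr.eq_or_lt with h | h
    · exact partialDeriv_totalDxI_top (hg j) k J K (by omega)
    · rw [totalDxI_mem_ordLT (hg j) J k K (by omega), if_neg]
      rintro rfl
      omega

theorem partialDeriv_evolutionEquation
    (heq : totalDt (reactionDiffusion d g) f + κ • lap f + R = 0) (k : Fin m) (K : Fin n → ℕ) :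
    totalDt (reactionDiffusion d g) (partialDeriv (.u k K) f) + κ • lap (partialDeriv (.u k K) f) +
      (2 * κ) • ∑ i, totalDx i (shift i (jetDeriv k f) K) +
      (d k + κ) • ∑ i, shift i (shift i (jetDeriv k f)) K +
      (∑ j, jetPairing (fun J => partialDeriv (.u k K) (totalDxI J (g j))) (jetDeriv j f) +
        partialDeriv (.u k K) R) = 0 := by
  have hdiff := congrArg (partialDeriv (.u k K)) heq
  rw [map_add, map_add, map_zero, partialDeriv_totalDt_reactionDiffusion, Derivation.map_smul,
    partialDeriv_lap] at hdiff
  rw [← hdiff]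
  simp only [Algebra.smul_def, map_add, map_mul, map_ofNat]
  ring

section

variable [NeZero n]

theorem partialDeriv_top_eq_zero (hg : ∀ j, g j ∈ ordLT n m 1) (hf : f ∈ ordLT n m (r + 1))
    (hR : R ∈ ordLT n m (r + 1)) (heq : totalDt (reactionDiffusion d g) f + κ • lap f + R = 0)
    {k : Fin m} (hk : d k + κ ≠ 0) (J : Fin n → ℕ) (hJ : ∑ i, J i = r) :
    partialDeriv (.u k J) f = 0 := by
  refine eq_zero_of_sum_shift_shift (h := jetDeriv k f) (fun K hK => ?_) J hJ
  have htop := partialDeriv_evolutionEquation heq k K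
  have hshift : ∑ i, totalDx i (shift i (jetDeriv k f) K) = 0 := by
    refine Finset.sum_eq_zero fun i _ => ?_
    rcases shift_eq_zero_or i (jetDeriv k f) K with h₁ | ⟨K', rfl, h₁⟩
    · rw [h₁, map_zero]
    · rw [sum_add_single] at hK
      rw [h₁, jetDeriv_apply, hf k K' (by omega), map_zero]
  rw [hf k K (by omega), hR k K (by omega), hshift,
    sum_jetPairing_reaction_of_lt hg hf k (by omega)] at htop
  simp only [map_zero, smul_zero, zero_add, add_zero] at htop
  exact (smul_eq_zero.1 htop).resolve_left hk

theorem uIndep_partialDeriv_top (hg : ∀ j, g j ∈ ordLT n m 1) (hf : f ∈ ordLT n m (r + 1))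
    (hR : R ∈ ordLT n m (r + 1)) (heq : totalDt (reactionDiffusion d g) f + κ • lap f + R = 0)
    {k : Fin m} (hk : d k + κ = 0) (hκ : κ ≠ 0) (J : Fin n → ℕ) (hJ : ∑ i, J i = r) :
    UIndep (partialDeriv (.u k J) f) := by
  refine uIndep_of_sum_totalDx_shift (h := jetDeriv k f) (fun K hK => ?_) J hJ
  have htop := partialDeriv_evolutionEquation heq k K
  rw [hf k K (by omega), hR k K (by omega), hk,
    sum_jetPairing_reaction_of_lt hg hf k (by omega)] at htop
  simp only [map_zero, smul_zero, zero_smul, zero_add, add_zero] at htop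
  rw [(smul_eq_zero.1 htop).resolve_left (by simpa using hκ)]
  exact zero_mem _

theorem uIndep_reaction_top (hg : ∀ j, g j ∈ ordLT n m 1) (hf : f ∈ ordLT n m (r + 1))
    (hR : R ∈ ordLT n m (r + 1)) (heq : totalDt (reactionDiffusion d g) f + κ • lap f + R = 0)
    {k : Fin m} (hk : d k + κ = 0) (hκ : κ ≠ 0)
    (hother : ∀ j ≠ k, ∀ J : Fin n → ℕ, ∑ i, J i = r → partialDeriv (.u j J) f = 0)
    (hR₁ : ∀ J : Fin n → ℕ, ∑ i, J i = r → partialDeriv (.u k J) R ∈ ordLT n m 1)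
    (K : Fin n → ℕ) (hK : ∑ i, K i = r) :
    UIndep (partialDeriv (.u k 0) (g k) * partialDeriv (.u k K) f + partialDeriv (.u k K) R) := by
  have hα := uIndep_partialDeriv_top hg hf hR heq hk hκ
  have htop (J : Fin n → ℕ) (hJ : ∑ i, J i = r) :
      totalDt (reactionDiffusion d g) (partialDeriv (.u k J) f) +
        κ • lap (partialDeriv (.u k J) f) +
        (2 * κ) • ∑ i, totalDx i (shift i (jetDeriv k f) J) +
        (partialDeriv (.u k 0) (g k) * partialDeriv (.u k J) f + partialDeriv (.u k J) R) = 0 := by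
    have := partialDeriv_evolutionEquation heq k J
    rwa [hk, zero_smul, add_zero, sum_jetPairing_reaction_of_eq hg hf k hJ,
      Finset.sum_eq_single k (fun j _ hj => by rw [hother j hj J hJ, mul_zero]) (by simp)] at this
  have hlinear (J : Fin n → ℕ) (hJ : ∑ i, J i = r) :
      UIndep (totalDt (reactionDiffusion d g) (partialDeriv (.u k J) f) +
        κ • lap (partialDeriv (.u k J) f)) := by
    rw [(hα J hJ).totalDt_eq, ← mem_ordLT_zero]
    exact add_mem (((hα J hJ).partialDeriv _).mem_ordLT 0)
      (Subalgebra.smul_mem _ ((hα J hJ).lap.mem_ordLT 0) κ)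
  have hshift : UIndep (∑ i, totalDx i (shift i (jetDeriv k f) K)) := by
    refine uIndep_sum_totalDx_shift (fun J hJ => ?_) K hK
    have hmem := neg_mem (add_mem ((hlinear J hJ).mem_ordLT 1) (add_mem (mul_mem
      (partialDeriv_mem_ordLT (hg k) (.u k 0)) ((hα J hJ).mem_ordLT 1)) (hR₁ J hJ)))
    rw [← eq_neg_of_add_eq_zero_right ((add_right_comm _ _ _).symm.trans (htop J hJ))] at hmem
    rw [← inv_smul_smul₀ (mul_ne_zero two_ne_zero hκ) (∑ i, totalDx i _)]
    exact Subalgebra.smul_mem _ hmem _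
  rw [eq_neg_of_add_eq_zero_right (htop K hK), ← mem_ordLT_zero]
  exact neg_mem (add_mem ((hlinear K hK).mem_ordLT 0)
    (Subalgebra.smul_mem _ (hshift.mem_ordLT 0) _))

end

end EvolutionEquation

/-- Cosymmetries of the system `∂u^k/∂t = F^k`: the solutions `χ` of the adjoint of the linearized
equations. Characteristics of conserved currents are of this kind. -/
def IsCosymmetry (F : Fin m → DiffFun n m) (χ : Fin m → DiffFun n m) : Prop :=
  ∀ k, totalDt F (χ k) + ∑ j, jetAdjoint (χ j • jetDeriv k (F j)) = 0

theorem isCosymmetry_eulerOp {F : Fin m → DiffFun n m} {J₀ : DiffFun n m}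
    {J : Fin n → DiffFun n m} (hJ : totalDt F J₀ + ∑ i, totalDx i (J i) = 0) :
    IsCosymmetry F fun k => eulerOp k J₀ := fun k => by
  rw [← eulerOp_totalDt, eq_neg_of_add_eq_zero_left hJ, map_neg, map_sum]
  simp [eulerOp_totalDx]

theorem jetAdjoint_smul_jetDeriv_of_mem_ordLT_one {f : DiffFun n m} (hf : f ∈ ordLT n m 1)
    (k : Fin m) (h : DiffFun n m) :
    jetAdjoint (h • jetDeriv k f) = partialDeriv (.u k 0) f * h := by
  have hsingle : jetDeriv k f = Finsupp.single 0 (partialDeriv (.u k 0) f) := by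
    ext1 K
    by_cases hK : K = 0
    · simp [hK]
    · rw [Finsupp.single_eq_of_ne hK, jetDeriv_apply, hf k K]
      by_contra hsum
      exact hK (funext fun i =>
        Finset.sum_eq_zero_iff.1 (by omega : ∑ i, K i = 0) i (Finset.mem_univ i))
  rw [hsingle, Finsupp.smul_single, jetAdjoint_single_zero, smul_eq_mul, mul_comm]

theorem jetAdjoint_smul_jetDeriv_lap_coord (j k : Fin m) (h : DiffFun n m) :
    jetAdjoint (h • jetDeriv k (lap (coord (.u j 0)))) = if k = j then lap h else 0 := by
  simp only [lap_apply, map_sum, Finset.smul_sum, jetAdjoint_smul_jetDeriv_totalDx, jetDeriv_coord]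
  split_ifs
  · simp [jetAdjoint_single_zero]
  · simp

section ReactionDiffusion

variable {d : Fin m → ℝ} {g χ : Fin m → DiffFun n m}

theorem IsCosymmetry.reactionDiffusion_eq (hχ : IsCosymmetry (reactionDiffusion d g) χ)
    (hg : ∀ j, g j ∈ ordLT n m 1) (k : Fin m) :
    totalDt (reactionDiffusion d g) (χ k) + d k • lap (χ k) +
      ∑ j, partialDeriv (.u k 0) (g j) * χ j = 0 := by
  rw [← hχ k, add_assoc]
  simp only [reactionDiffusion, map_add, Derivation.map_smul, smul_add, smul_comm _ (d _), map_smul,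
    jetAdjoint_smul_jetDeriv_lap_coord, jetAdjoint_smul_jetDeriv_of_mem_ordLT_one (hg _), smul_ite,
    smul_zero, Finset.sum_add_distrib, Finset.sum_ite_eq, Finset.mem_univ, if_true]

theorem sum_partialDeriv_mul_mem_ordLT {r : ℕ} (hg : ∀ j, g j ∈ ordLT n m 1)
    (hr : ∀ j, χ j ∈ ordLT n m (r + 1)) (l : Fin m) :
    ∑ j, partialDeriv (.u l 0) (g j) * χ j ∈ ordLT n m (r + 1) :=
  sum_mem fun j _ =>
    mul_mem (ordLT_mono (Nat.le_add_left 1 r) (partialDeriv_mem_ordLT (hg j) _)) (hr j)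

variable [NeZero n] {r : ℕ} {k l : Fin m}

theorem IsCosymmetry.partialDeriv_eq_zero (hχ : IsCosymmetry (reactionDiffusion d g) χ)
    (hg : ∀ j, g j ∈ ordLT n m 1) (hr : ∀ j, χ j ∈ ordLT n m (r + 1)) (hkl : d k + d l ≠ 0)
    (J : Fin n → ℕ) (hJ : ∑ i, J i = r) : partialDeriv (.u k J) (χ l) = 0 :=
  partialDeriv_top_eq_zero hg (hr l) (sum_partialDeriv_mul_mem_ordLT hg hr l)
    (hχ.reactionDiffusion_eq hg l) hkl J hJ

theorem IsCosymmetry.uIndep_partialDeriv (hχ : IsCosymmetry (reactionDiffusion d g) χ)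
    (hg : ∀ j, g j ∈ ordLT n m 1) (hr : ∀ j, χ j ∈ ordLT n m (r + 1)) (hkl : d k + d l = 0)
    (hl : d l ≠ 0) (J : Fin n → ℕ) (hJ : ∑ i, J i = r) : UIndep (partialDeriv (.u k J) (χ l)) :=
  uIndep_partialDeriv_top hg (hr l) (sum_partialDeriv_mul_mem_ordLT hg hr l)
    (hχ.reactionDiffusion_eq hg l) hkl hl J hJ

theorem IsCosymmetry.uIndep_reaction (hχ : IsCosymmetry (reactionDiffusion d g) χ)
    (hg : ∀ j, g j ∈ ordLT n m 1) (hr : ∀ j, χ j ∈ ordLT n m (r + 1)) (hd : Function.Injective d)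
    (hkl : d k + d l = 0) (hl : d l ≠ 0) (J : Fin n → ℕ) (hJ : ∑ i, J i = r) :
    UIndep ((partialDeriv (.u k 0) (g k) + partialDeriv (.u l 0) (g l)) *
        partialDeriv (.u k J) (χ l) +
      ∑ j, partialDeriv (.u k J) (partialDeriv (.u l 0) (g j)) * χ j) := by
  have hleft (j : Fin m) (hj : j ≠ k) (K : Fin n → ℕ) (hK : ∑ i, K i = r) :
      partialDeriv (.u j K) (χ l) = 0 :=
    hχ.partialDeriv_eq_zero hg hr (fun h => hj (hd (by linarith))) K hK
  have hright (j : Fin m) (hj : j ≠ l) (K : Fin n → ℕ) (hK : ∑ i, K i = r) :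
      partialDeriv (.u k K) (χ j) = 0 :=
    hχ.partialDeriv_eq_zero hg hr (fun h => hj (hd (by linarith))) K hK
  have hexpand (K : Fin n → ℕ) (hK : ∑ i, K i = r) :
      partialDeriv (.u k K) (∑ j, partialDeriv (.u l 0) (g j) * χ j) =
        partialDeriv (.u l 0) (g l) * partialDeriv (.u k K) (χ l) +
          ∑ j, partialDeriv (.u k K) (partialDeriv (.u l 0) (g j)) * χ j := by
    simp only [map_sum, Derivation.leibniz, smul_eq_mul, Finset.sum_add_distrib]
    rw [Finset.sum_eq_single l (fun j _ hj => by rw [hright j hj K hK, mul_zero]) (by simp)]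
    simp only [mul_comm (χ _)]
  have hlow (j : Fin m) (K : Fin n → ℕ) (hK : ∑ i, K i = r) :
      partialDeriv (.u k K) (partialDeriv (.u l 0) (g j)) * χ j ∈ ordLT n m 1 := by
    have hgl := partialDeriv_mem_ordLT (hg j) (.u l 0)
    rcases r.eq_zero_or_pos with rfl | hpos
    · exact mul_mem (partialDeriv_mem_ordLT hgl _) (hr j)
    · rw [hgl k K (by omega), zero_mul]
      exact zero_mem _
  rw [add_mul, add_assoc, ← hexpand J hJ]
  refine uIndep_reaction_top hg (hr l) (sum_partialDeriv_mul_mem_ordLT hg hr l)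
    (hχ.reactionDiffusion_eq hg l) hkl hl hleft (fun K hK => ?_) J hJ
  rw [hexpand K hK]
  exact add_mem (mul_mem (partialDeriv_mem_ordLT (hg l) _)
    ((hχ.uIndep_partialDeriv hg hr hkl hl K hK).mem_ordLT 1)) (sum_mem fun j _ => hlow j K hK)

end ReactionDiffusion

section Brusselator

variable {a b c : ℝ}

variable (n) in
/-- The unknown function `v` as a differential function. -/
abbrev V : DiffFun n 2 := coord (.u 0 0)

variable (n) in
/-- The unknown function `w` as a differential function. -/
abbrev W : DiffFun n 2 := coord (.u 1 0)

variable (n a b) in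
/-- The reaction terms of the Brusselator system. -/
def reaction : Fin 2 → DiffFun n 2 :=
  ![V n ^ 2 * W n - (b + 1) • V n + algebraMap ℝ _ a, b • V n - V n ^ 2 * W n]

variable (n a b c) in
/-- The right-hand sides of the Brusselator system as differential functions. -/
abbrev brusselator : Fin 2 → DiffFun n 2 := reactionDiffusion ![1, c] (reaction n a b)

theorem lap_coord_apply (k : Fin m) (p : Coord n m → ℝ) :
    lap (coord (.u k 0) : DiffFun n m) p = ∑ i, p (.u k (Pi.single i 2)) := by
  rw [lap_apply, DiffFun.sum_apply]
  refine Finset.sum_congr rfl fun i _ => ?_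
  rw [totalDx_coord, totalDx_coord, zero_add, ← Pi.single_add, coord_apply]

theorem coe_brusselator : (fun k => ⇑(brusselator n a b c k)) = rhs n a b c := by
  funext k p
  fin_cases k <;> simp [reactionDiffusion, reaction, rhs, lap_coord_apply] <;> ring

theorem reaction_mem_ordLT (j : Fin 2) : reaction n a b j ∈ ordLT n 2 1 := by
  have hV : V n ∈ ordLT n 2 1 := coord_mem_ordLT_one 0
  have hW : W n ∈ ordLT n 2 1 := coord_mem_ordLT_one 1
  have hVVW := mul_mem (pow_mem hV 2) hW
  fin_cases j
  · exact add_mem (sub_mem hVVW (Subalgebra.smul_mem _ hV _)) (algebraMap_mem _ a)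
  · exact sub_mem (Subalgebra.smul_mem _ hV _) hVVW

@[simp]
theorem partialDeriv_v_V : partialDeriv (.u 0 0) (V n) = 1 := by simp [partialDeriv_coord]

@[simp]
theorem partialDeriv_v_W : partialDeriv (.u 0 0) (W n) = 0 := by simp [partialDeriv_coord]

@[simp]
theorem partialDeriv_w_V : partialDeriv (.u 1 0) (V n) = 0 := by simp [partialDeriv_coord]

@[simp]
theorem partialDeriv_w_W : partialDeriv (.u 1 0) (W n) = 1 := by simp [partialDeriv_coord]

theorem partialDeriv_v_reaction_zero :
    partialDeriv (.u 0 0) (reaction n a b 0) = (2 : ℝ) • (V n * W n) - algebraMap ℝ _ (b + 1) := by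
  simp [reaction, Derivation.leibniz_pow, Algebra.smul_def, map_ofNat]
  ring

theorem partialDeriv_w_reaction_zero :
    partialDeriv (.u 1 0) (reaction n a b 0) = V n ^ 2 := by
  simp [reaction, Derivation.leibniz_pow]

theorem partialDeriv_v_reaction_one :
    partialDeriv (.u 0 0) (reaction n a b 1) = algebraMap ℝ _ b - (2 : ℝ) • (V n * W n) := by
  simp [reaction, Derivation.leibniz_pow, Algebra.smul_def, map_ofNat]
  ring

theorem partialDeriv_w_reaction_one :
    partialDeriv (.u 1 0) (reaction n a b 1) = -V n ^ 2 := by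
  simp [reaction, Derivation.leibniz_pow]

theorem partialDeriv_u_reaction_deriv_eq_zero (k l j : Fin 2) {J : Fin n → ℕ} (hJ : ∑ i, J i ≠ 0) :
    partialDeriv (.u k J) (partialDeriv (.u l 0) (reaction n a b j)) = 0 :=
  partialDeriv_mem_ordLT (reaction_mem_ordLT j) _ k J (Nat.one_le_iff_ne_zero.2 hJ)

theorem eq_zero_of_sum_eq_zero {J : Fin n → ℕ} (hJ : ∑ i, J i = 0) : J = 0 :=
  funext fun i => Finset.sum_eq_zero_iff.1 hJ i (Finset.mem_univ i)

variable {r : ℕ} {χ : Fin 2 → DiffFun n 2}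

theorem sum_partialDeriv_w_v_reaction_mul (χ : Fin 2 → DiffFun n 2) :
    ∑ j, partialDeriv (.u 1 0) (partialDeriv (.u 0 0) (reaction n a b j)) * χ j =
      (2 : ℝ) • (V n * (χ 0 - χ 1)) := by
  rw [mul_sub, smul_sub]
  simp [Fin.sum_univ_two, partialDeriv_v_reaction_zero, partialDeriv_v_reaction_one,
    sub_eq_add_neg]

theorem partialDeriv_v_v_V_sq_mul {h : DiffFun n 2} (hh : UIndep h) :
    partialDeriv (.u 0 0) (partialDeriv (.u 0 0) (V n ^ 2 * h)) = (2 : ℝ) • h := by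
  simp [pow_two, hh.partialDeriv_u_eq_zero, two_smul, mul_add]

theorem partialDeriv_v_w_trace_mul {α : DiffFun n 2} (hα : UIndep α) :
    partialDeriv (.u 0 0) (partialDeriv (.u 1 0)
      ((partialDeriv (.u 0 0) (reaction n a b 0) + partialDeriv (.u 1 0) (reaction n a b 1)) * α)) =
      (2 : ℝ) • α := by
  rw [partialDeriv_v_reaction_zero, partialDeriv_w_reaction_one]
  simp [Derivation.leibniz_pow, hα.partialDeriv_u_eq_zero, mul_comm α]

theorem partialDeriv_v_w_V_mul {h : DiffFun n 2} (hh : UIndep (partialDeriv (.u 1 0) h)) :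
    partialDeriv (.u 0 0) (partialDeriv (.u 1 0) (V n * h)) = partialDeriv (.u 1 0) h := by
  simp [hh.partialDeriv_u_eq_zero]

theorem eq_zero_of_uIndep_trace_mul_add {α h : DiffFun n 2} (hα : UIndep α)
    (hh : partialDeriv (.u 1 0) h = α ∨ partialDeriv (.u 1 0) h = 0)
    (hsum : UIndep ((partialDeriv (.u 0 0) (reaction n a b 0) +
      partialDeriv (.u 1 0) (reaction n a b 1)) * α + (2 : ℝ) • (V n * h))) : α = 0 := by
  have hvw := congrArg (partialDeriv (.u 0 0)) (hsum.partialDeriv_u_eq_zero 1 0)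
  rw [map_add, map_add, partialDeriv_v_w_trace_mul hα, Derivation.map_smul, Derivation.map_smul,
    map_zero] at hvw
  rcases hh with hh | hh
  · rw [partialDeriv_v_w_V_mul (hh ▸ hα), hh, ← add_smul] at hvw
    exact (smul_eq_zero.1 hvw).resolve_left (by norm_num)
  · rw [partialDeriv_v_w_V_mul (hh ▸ mem_ordLT_zero.1 (zero_mem _)), hh, smul_zero, add_zero] at hvw
    exact (smul_eq_zero.1 hvw).resolve_left two_ne_zero

/-- The conditions on a common value `χ` of both components of a cosymmetry of the Brusselator
system. They amount to `χ_t + Δχ = χ` and `χ_t + c Δχ = 0` for a function `χ` of `t` and `x`. -/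
structure IsHeatMultiplier (c : ℝ) (χ : DiffFun n m) : Prop where
  uIndep : UIndep χ
  partialDeriv_t_add_lap : partialDeriv .t χ + lap χ = χ
  partialDeriv_t_add_smul_lap : partialDeriv .t χ + c • lap χ = 0

theorem injective_one_neg_one : Function.Injective (![1, -1] : Fin 2 → ℝ) := by
  simp only [Function.Injective, Fin.forall_fin_two]
  norm_num

variable [NeZero n]

theorem IsCosymmetry.partialDeriv_self_eq_zero (hχ : IsCosymmetry (brusselator n a b c) χ)
    (hr : ∀ j, χ j ∈ ordLT n 2 (r + 1)) (hc : c ≠ 0) (k : Fin 2) (J : Fin n → ℕ)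
    (hJ : ∑ i, J i = r) : partialDeriv (.u k J) (χ k) = 0 := by
  refine hχ.partialDeriv_eq_zero reaction_mem_ordLT hr ?_ J hJ
  fin_cases k <;> simp [hc]

theorem IsCosymmetry.partialDeriv_w_zero_eq_zero (hχ : IsCosymmetry (brusselator n a b c) χ)
    (hr : ∀ j, χ j ∈ ordLT n 2 (r + 1)) (hc : c ≠ 0) (J : Fin n → ℕ) (hJ : ∑ i, J i = r) :
    partialDeriv (.u 1 J) (χ 0) = 0 := by
  by_cases hc1 : c + 1 = 0
  · obtain rfl : c = -1 := eq_neg_of_add_eq_zero_left hc1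
    have hα := hχ.uIndep_partialDeriv (k := 1) (l := 0) reaction_mem_ordLT hr (by simp) (by simp)
      J hJ
    have hreaction := hχ.uIndep_reaction (k := 1) (l := 0) reaction_mem_ordLT hr
      injective_one_neg_one (by simp) (by simp) J hJ
    rw [add_comm (partialDeriv (.u 1 0) _)] at hreaction
    by_cases hr0 : r = 0
    · obtain rfl := eq_zero_of_sum_eq_zero (hJ.trans hr0)
      rw [sum_partialDeriv_w_v_reaction_mul] at hreaction
      exact eq_zero_of_uIndep_trace_mul_add hα
        (.inl (by rw [map_sub, hχ.partialDeriv_self_eq_zero hr hc 1 0 hJ, sub_zero])) hreaction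
    · exact eq_zero_of_uIndep_trace_mul_add (h := 0) hα (.inr (map_zero _)) (by
        simpa [partialDeriv_u_reaction_deriv_eq_zero 1 0 _ (hJ.trans_ne hr0)] using hreaction)
  · exact hχ.partialDeriv_eq_zero reaction_mem_ordLT hr (by simpa) J hJ

theorem IsCosymmetry.partialDeriv_v_one_eq_zero (hχ : IsCosymmetry (brusselator n a b c) χ)
    (hr : ∀ j, χ j ∈ ordLT n 2 (r + 1)) (hc : c ≠ 0) (J : Fin n → ℕ) (hJ : ∑ i, J i = r) :
    partialDeriv (.u 0 J) (χ 1) = 0 := by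
  by_cases hc1 : 1 + c = 0
  · obtain rfl : c = -1 := (neg_eq_of_add_eq_zero_right hc1).symm
    have hα := hχ.uIndep_partialDeriv (k := 0) (l := 1) reaction_mem_ordLT hr (by simp) (by simp)
      J hJ
    have hreaction := hχ.uIndep_reaction (k := 0) (l := 1) reaction_mem_ordLT hr
      injective_one_neg_one (by simp) (by simp) J hJ
    by_cases hr0 : r = 0
    · obtain rfl := eq_zero_of_sum_eq_zero (hJ.trans hr0)
      simp only [partialDeriv_comm (.u 0 0) (.u 1 0), sum_partialDeriv_w_v_reaction_mul]
        at hreaction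
      refine eq_zero_of_uIndep_trace_mul_add hα (.inr ?_) hreaction
      rw [map_sub, hχ.partialDeriv_w_zero_eq_zero hr hc 0 hJ,
        hχ.partialDeriv_self_eq_zero hr hc 1 0 hJ, sub_zero]
    · exact eq_zero_of_uIndep_trace_mul_add (h := 0) hα (.inr (map_zero _)) (by
        simpa [partialDeriv_u_reaction_deriv_eq_zero 0 1 _ (hJ.trans_ne hr0)] using hreaction)
  · exact hχ.partialDeriv_eq_zero reaction_mem_ordLT hr (by simpa) J hJ

theorem IsCosymmetry.mem_ordLT_of_mem_ordLT_succ (hχ : IsCosymmetry (brusselator n a b c) χ)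
    (hc : c ≠ 0) (hr : ∀ j, χ j ∈ ordLT n 2 (r + 1)) (j : Fin 2) : χ j ∈ ordLT n 2 r := by
  intro k K hK
  rcases hK.lt_or_eq with hlt | heq
  · exact hr j k K hlt
  · fin_cases j <;> fin_cases k
    · exact hχ.partialDeriv_self_eq_zero hr hc 0 K heq.symm
    · exact hχ.partialDeriv_w_zero_eq_zero hr hc K heq.symm
    · exact hχ.partialDeriv_v_one_eq_zero hr hc K heq.symm
    · exact hχ.partialDeriv_self_eq_zero hr hc 1 K heq.symm

theorem IsCosymmetry.uIndep (hχ : IsCosymmetry (brusselator n a b c) χ) (hc : c ≠ 0) (j : Fin 2) :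
    UIndep (χ j) := by
  have hdescend (r : ℕ) (hr : ∀ j, χ j ∈ ordLT n 2 r) : UIndep (χ j) := by
    induction r with
    | zero => exact mem_ordLT_zero.1 (hr j)
    | succ r ih => exact ih (hχ.mem_ordLT_of_mem_ordLT_succ hc hr)
  choose ρ hρ using fun j => exists_mem_ordLT (χ j)
  exact hdescend (∑ j, ρ j) fun j =>
    ordLT_mono (Finset.single_le_sum (fun _ _ => Nat.zero_le _) (Finset.mem_univ j)) (hρ j)

theorem IsCosymmetry.adjoint_equation_v (hχ : IsCosymmetry (brusselator n a b c) χ) (hc : c ≠ 0) :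
    partialDeriv .t (χ 0) + lap (χ 0) + ((2 : ℝ) • (V n * W n) - algebraMap ℝ _ (b + 1)) * χ 0 +
      (algebraMap ℝ _ b - (2 : ℝ) • (V n * W n)) * χ 1 = 0 := by
  simpa [(hχ.uIndep hc 0).totalDt_eq, partialDeriv_v_reaction_zero, partialDeriv_v_reaction_one,
    Fin.sum_univ_two, add_assoc] using hχ.reactionDiffusion_eq reaction_mem_ordLT 0

theorem IsCosymmetry.adjoint_equation_w (hχ : IsCosymmetry (brusselator n a b c) χ) (hc : c ≠ 0) :
    partialDeriv .t (χ 1) + c • lap (χ 1) + V n ^ 2 * (χ 0 - χ 1) = 0 := by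
  rw [mul_sub, sub_eq_add_neg]
  simpa [(hχ.uIndep hc 1).totalDt_eq, partialDeriv_w_reaction_zero, partialDeriv_w_reaction_one,
    Fin.sum_univ_two] using hχ.reactionDiffusion_eq reaction_mem_ordLT 1

theorem IsCosymmetry.zero_eq_one (hχ : IsCosymmetry (brusselator n a b c) χ) (hc : c ≠ 0) :
    χ 0 = χ 1 := by
  have h₀ := hχ.uIndep hc 0
  have h₁ := hχ.uIndep hc 1
  have hsub : UIndep (χ 0 - χ 1) := fun k => by rw [map_sub, h₀ k, h₁ k, sub_zero]
  have hvv := congrArg (fun f => partialDeriv (.u 0 0) (partialDeriv (.u 0 0) f))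
    (hχ.adjoint_equation_w hc)
  simp only [map_add, Derivation.map_smul, (h₁.partialDeriv .t).partialDeriv_u_eq_zero,
    h₁.lap.partialDeriv_u_eq_zero, partialDeriv_v_v_V_sq_mul hsub, map_zero, smul_zero,
    zero_add] at hvv
  exact sub_eq_zero.1 ((smul_eq_zero.1 hvv).resolve_left two_ne_zero)

theorem IsCosymmetry.isHeatMultiplier (hχ : IsCosymmetry (brusselator n a b c) χ) (hc : c ≠ 0) :
    IsHeatMultiplier c (χ 0) := by
  have hv := hχ.adjoint_equation_v hc
  have hw := hχ.adjoint_equation_w hc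
  rw [← hχ.zero_eq_one hc] at hv hw
  rw [sub_self, mul_zero, add_zero] at hw
  refine ⟨hχ.uIndep hc 0, ?_, hw⟩
  rw [map_add, map_one] at hv
  linear_combination hv

end Brusselator

theorem D_zero_coe (F : Fin m → DiffFun n m) (f : DiffFun n m) :
    D (fun k => ⇑(F k)) 0 f = totalDt F f := (coe_totalDt F f).symm

theorem D_succ_coe (F : Fin m → DiffFun n m) (i : Fin n) (f : DiffFun n m) :
    D (fun k => ⇑(F k)) i.succ f = totalDx i f := (coe_totalDx i f).symm

theorem IsConservedCurrent.exists_coe_eq {F : Fin m → Fun n m} {J : Fin (n + 1) → Fun n m}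
    (hJ : IsConservedCurrent F J) : ∃ J' : Fin (n + 1) → DiffFun n m, (fun k => ⇑(J' k)) = J :=
  ⟨fun k => ⟨J k, hJ.1 k⟩, rfl⟩

theorem isConservedCurrent_coe_iff {F : Fin m → DiffFun n m} {J : Fin (n + 1) → DiffFun n m} :
    IsConservedCurrent (fun k => ⇑(F k)) (fun k => ⇑(J k)) ↔
      totalDt F (J 0) + ∑ i : Fin n, totalDx i (J i.succ) = 0 := by
  have hdiv (p : Coord n m → ℝ) : ∑ k, D (fun k => ⇑(F k)) k (J k) p =
      (totalDt F (J 0) + ∑ i : Fin n, totalDx i (J i.succ)) p := by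
    rw [Fin.sum_univ_succ, D_zero_coe, DiffFun.add_apply, DiffFun.sum_apply]
    simp only [D_succ_coe]
  refine ⟨fun hJ => DiffFun.ext fun p => ?_, fun hJ => ⟨fun k => (J k).isDiffFun, fun p => ?_⟩⟩
  · rw [← hdiv, hJ.2, DiffFun.zero_apply]
  · rw [hdiv, hJ, DiffFun.zero_apply]

theorem endMonomial_neg_totalDxEnd (I : Fin n → ℕ) (f : DiffFun n m) :
    endMonomial (fun i => -totalDxEnd i) I f = (-1 : ℝ) ^ (∑ i, I i) • totalDxI I f := by
  induction I using multiIndex_induction with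
  | zero => simp
  | add_single I i ih =>
    rw [endMonomial_add_single neg_totalDxEnd_commute, totalDxI_add_single, sum_add_single,
      Module.End.mul_apply, ih]
    simp [pow_succ]

theorem characteristic_coe (J : Fin (n + 1) → DiffFun n m) (k : Fin m) :
    characteristic (fun l => ⇑(J l)) k = eulerOp k (J 0) := by
  funext p
  have hterm (I : Fin n → ℕ) : (-1 : ℝ) ^ (∑ i, I i) * DxI I (pd (.u k I) (J 0)) p =
      endMonomial (fun i => -totalDxEnd i) I (jetDeriv k (J 0) I) p := by
    rw [endMonomial_neg_totalDxEnd, DiffFun.smul_apply, coe_totalDxI, jetDeriv_apply]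
    rfl
  rw [characteristic, finsum_congr hterm,
    finsum_eq_sum_of_support_subset (s := (jetDeriv k (J 0)).support), eulerOp_apply, jetAdjoint,
    assemble, Finsupp.lsum_apply, Finsupp.sum, DiffFun.sum_apply]
  · rfl
  · intro I hI
    rw [Finset.mem_coe, Finsupp.mem_support_iff]
    intro hzero
    exact hI (by simp [hzero])

theorem sum_Iio_succ {M : Type*} [AddCommMonoid M] {N : ℕ} (g : Fin (N + 1) → M) (k : Fin N) :
    ∑ l ∈ Finset.Iio k.succ, g l = g 0 + ∑ l ∈ Finset.Iio k, g l.succ := by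
  simp only [← Finset.filter_gt_eq_Iio, Finset.sum_filter, Fin.sum_univ_succ, Fin.succ_pos,
    if_true, Fin.succ_lt_succ_iff]

theorem isTrivialCurrent_of_eulerOp_eq_zero [NeZero n] {F : Fin m → DiffFun n m}
    {J : Fin (n + 1) → DiffFun n m}
    (hJ : totalDt F (J 0) + ∑ i : Fin n, totalDx i (J i.succ) = 0)
    (he : ∀ k, eulerOp k (J 0) = 0) :
    IsTrivialCurrent (fun k => ⇑(F k)) (fun k => ⇑(J k)) := by
  obtain ⟨P, L, hP, hL⟩ := exists_potential_of_eulerOp_eq_zero F hJ he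
  let M : Fin (n + 1) → Fin (n + 1) → DiffFun n m :=
    Fin.cons (Fin.cons 0 P) fun i => Fin.cons 0 (L i)
  refine ⟨fun k l => M k l, fun k l _ => (M k l).isDiffFun, fun k p => ?_⟩
  cases k using Fin.cases with
  | zero =>
    beta_reduce
    rw [hP, ← bot_eq_zero, Finset.Iio_bot, bot_eq_zero, Fin.sum_Ioi_zero]
    simp [M, D_succ_coe]
  | succ i =>
    beta_reduce
    rw [hL, sum_Iio_succ, Fin.sum_Ioi_succ]
    simp [M, D_zero_coe, D_succ_coe, add_sub_assoc]

/-- The point with time `s`, space variables `x` and vanishing `u^k_I`. -/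
def point (s : ℝ) (x : Fin n → ℝ) : Coord n m → ℝ
  | .t => s
  | .x i => x i
  | .u _ _ => 0

theorem point_update_t (s r : ℝ) (x : Fin n → ℝ) :
    Function.update (point s x : Coord n m → ℝ) .t r = point r x := by
  funext z
  cases z <;> simp [point]

theorem point_update_x (s r : ℝ) (x : Fin n → ℝ) (i : Fin n) :
    Function.update (point s x : Coord n m → ℝ) (.x i) r = point s (Function.update x i r) := by
  funext z
  cases z <;> simp [point, Function.update_apply]

theorem UIndep.apply_eq {f : DiffFun n m} (hf : UIndep f) (p : Coord n m → ℝ) :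
    f p = f (point (p .t) (space p)) := by
  have hzero : f - atZero isU f = 0 := by
    rw [sub_atZero_isU]
    exact Finset.sum_eq_zero fun k _ => by rw [hf k, map_zero, map_zero]
  have hscale : scale isU 0 p = point (p .t) (space p) := by
    funext z
    cases z <;> simp [point, scale, isU, space]
  conv_lhs => rw [sub_eq_zero.1 hzero]
  exact congrArg f hscale

theorem contDiff_comp_point (f : DiffFun n m) (s : ℝ) :
    ContDiff ℝ ∞ fun x => f (point s x) := by
  obtain ⟨S, g, hg, hfg⟩ := f.isDiffFun
  simp only [hfg]
  refine hg.comp (contDiff_pi.2 ?_)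
  rintro ⟨_ | _ | _, _⟩
  · exact contDiff_const
  · exact contDiff_apply ℝ ℝ _
  · exact contDiff_const

theorem pd_comp_point (f : DiffFun n m) (s : ℝ) (i : Fin n) :
    pd i (fun x => f (point s x)) = fun x => partialDeriv (.x i) f (point s x) := by
  funext x
  rw [partialDeriv_apply, pd, pd]
  simp only [point_update_x]
  rfl

theorem space_update_x (p : Coord n m → ℝ) (i : Fin n) (r : ℝ) :
    space (Function.update p (.x i) r) = Function.update (space p) i r := by
  funext j
  simp [space, Function.update_apply]

theorem space_update_of_ne (p : Coord n m → ℝ) {z : Coord n m} (hz : ∀ i, z ≠ .x i) (r : ℝ) :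
    space (Function.update p z r) = space p := by
  funext j
  simp [space, (hz j).symm]

section OfSpace

variable {G : (Fin n → ℝ) → ℝ}

/-- A smooth function of the space variables as a differential function. -/
def ofSpace (hG : ContDiff ℝ ∞ G) : DiffFun n m :=
  ⟨fun p => G (space p), Finset.univ.image .x,
    fun q => G fun i => q ⟨.x i, Finset.mem_image_of_mem _ (Finset.mem_univ i)⟩,
    hG.comp (by fun_prop), fun _ => rfl⟩

theorem ofSpace_apply (hG : ContDiff ℝ ∞ G) (p : Coord n m → ℝ) :
    ofSpace hG p = G (space p) := rfl

theorem partialDeriv_ofSpace_of_ne (hG : ContDiff ℝ ∞ G) {z : Coord n m} (hz : ∀ i, z ≠ .x i) :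
    partialDeriv z (ofSpace hG) = 0 := by
  refine DiffFun.ext fun p => ?_
  rw [partialDeriv_apply, pd]
  simp [ofSpace_apply, space_update_of_ne p hz]

theorem uIndep_ofSpace (hG : ContDiff ℝ ∞ G) : UIndep (ofSpace hG : DiffFun n m) :=
  fun _ => Finsupp.ext fun _ => partialDeriv_ofSpace_of_ne hG (by simp)

theorem totalDx_ofSpace_apply (hG : ContDiff ℝ ∞ G) (i : Fin n) (p : Coord n m → ℝ) :
    totalDx i (ofSpace hG) p = pd i G (space p) := by
  rw [(uIndep_ofSpace hG).totalDx_eq, partialDeriv_apply, pd, pd]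
  simp only [ofSpace_apply, space_update_x]
  rfl

theorem contDiff_pd (hG : ContDiff ℝ ∞ G) (i : Fin n) : ContDiff ℝ ∞ (pd i G) := by
  have hcomp := contDiff_comp_point (totalDx i (ofSpace hG : DiffFun n 0)) 0
  simp only [totalDx_ofSpace_apply] at hcomp
  exact hcomp

theorem totalDx_ofSpace (hG : ContDiff ℝ ∞ G) (i : Fin n) :
    totalDx i (ofSpace hG : DiffFun n m) = ofSpace (contDiff_pd hG i) :=
  DiffFun.ext fun p => totalDx_ofSpace_apply hG i p

theorem IsProfile.ofSpace_add_lap_eq_zero {c : ℝ} (hG : IsProfile c G) :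
    ofSpace hG.1 + (c - 1) • lap (ofSpace hG.1 : DiffFun n m) = 0 := by
  refine DiffFun.ext fun p => ?_
  simp only [lap_apply, totalDx_ofSpace, DiffFun.add_apply, DiffFun.smul_apply, DiffFun.sum_apply]
  exact hG.2 (space p)

theorem exists_isAntiderivatives (hG : ContDiff ℝ ∞ G) :
    ∃ H : Fin n → (Fin n → ℝ) → ℝ, IsAntiderivatives G H := by
  refine ⟨fun i x => antideriv (.x i) (ofSpace hG : DiffFun n 0) (point 0 x),
    fun i => ⟨contDiff_comp_point _ 0, fun x => ?_⟩⟩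
  rw [pd_comp_point, partialDeriv_antideriv_self]
  rfl

end OfSpace

variable (n m) in
/-- The exponential `e^{r t}` as a differential function. -/
def expTime (r : ℝ) : DiffFun n m :=
  ⟨fun p => Real.exp (r * p .t), {.t}, fun q => Real.exp (r * q ⟨.t, by simp⟩), by fun_prop,
    fun _ => rfl⟩

theorem expTime_apply (r : ℝ) (p : Coord n m → ℝ) : expTime n m r p = Real.exp (r * p .t) := rfl

theorem hasDerivAt_exp_mul (r s : ℝ) :
    HasDerivAt (fun s => Real.exp (r * s)) (r * Real.exp (r * s)) s := by
  simpa [mul_comm] using ((hasDerivAt_id' s).const_mul r).exp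

theorem partialDeriv_t_expTime (r : ℝ) : partialDeriv .t (expTime n m r) = r • expTime n m r := by
  refine DiffFun.ext fun p => ?_
  rw [partialDeriv_apply, pd]
  simp only [expTime_apply, Function.update_self]
  exact (hasDerivAt_exp_mul r (p .t)).deriv

theorem partialDeriv_expTime_of_ne (r : ℝ) {z : Coord n m} (hz : z ≠ .t) :
    partialDeriv z (expTime n m r) = 0 := by
  refine DiffFun.ext fun p => ?_
  rw [partialDeriv_apply, pd]
  simp [expTime_apply, hz.symm]

theorem uIndep_expTime (r : ℝ) : UIndep (expTime n m r) :=
  fun _ => Finsupp.ext fun _ => partialDeriv_expTime_of_ne r (by simp)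

theorem totalDx_expTime (i : Fin n) (r : ℝ) : totalDx i (expTime n m r) = 0 := by
  rw [(uIndep_expTime r).totalDx_eq, partialDeriv_expTime_of_ne r (by simp)]

theorem eq_mul_exp_of_partialDeriv_t {f : DiffFun n m} (hf : UIndep f) {r : ℝ}
    (ht : partialDeriv .t f = r • f) (p : Coord n m → ℝ) :
    f p = f (point 0 (space p)) * Real.exp (r * p .t) := by
  have hconst (s : ℝ) :
      HasDerivAt (fun s => f (point s (space p)) * Real.exp (-r * s)) 0 s := by
    have hf' := f.isDiffFun.hasDerivAt_update .t (point s (space p))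
    simp only [point_update_t] at hf'
    rw [← partialDeriv_apply, ht, DiffFun.smul_apply] at hf'
    change HasDerivAt _ _ s at hf'
    exact (hf'.mul (hasDerivAt_exp_mul (-r) s)).congr_deriv (by ring)
  have hvalue := is_const_of_deriv_eq_zero (fun s => (hconst s).differentiableAt)
    (fun s => (hconst s).deriv) (p .t) 0
  simp only [mul_zero, Real.exp_zero, mul_one] at hvalue
  rw [hf.apply_eq p, ← hvalue, mul_assoc, ← Real.exp_add]
  simp

section Current

variable {a b c : ℝ} {χ : DiffFun n 2} {K : Fin n → DiffFun n 2}

theorem sum_totalDx_green (f h : DiffFun n m) :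
    ∑ i, totalDx i (totalDx i f * h - f * totalDx i h) = lap f * h - f * lap h := by
  rw [lap_apply, lap_apply, Finset.sum_mul, Finset.mul_sum, ← Finset.sum_sub_distrib]
  refine Finset.sum_congr rfl fun i _ => ?_
  simp only [map_sub, Derivation.leibniz, smul_eq_mul]
  ring

theorem lap_mul_of_totalDx_eq_zero (f : DiffFun n m) {h : DiffFun n m}
    (hh : ∀ i, totalDx i h = 0) : lap (f * h) = lap f * h := by
  rw [lap_apply, lap_apply, Finset.sum_mul]
  refine Finset.sum_congr rfl fun i _ => ?_
  simp [hh, mul_comm h]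

/-- The current of the Brusselator system with characteristic `(χ, χ)`, for a heat multiplier `χ`
with antiderivatives `K i` in the variables `x i`. -/
def multiplierCurrent (a c : ℝ) (χ : DiffFun n 2) (K : Fin n → DiffFun n 2) :
    Fin (n + 1) → DiffFun n 2 :=
  Fin.cons (χ * (V n + W n)) fun i =>
    totalDx i χ * (V n + c • W n) - χ * totalDx i (V n + c • W n) - (a / n) • K i

theorem totalDt_mul_V_add_W (hχ : UIndep χ) :
    totalDt (brusselator n a b c) (χ * (V n + W n)) =
      partialDeriv .t χ * (V n + W n) +
        χ * (lap (V n + c • W n) - V n + algebraMap ℝ _ a) := by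
  have hsource : brusselator n a b c 0 + brusselator n a b c 1 =
      lap (V n + c • W n) - V n + algebraMap ℝ _ a := by
    simp [reactionDiffusion, reaction, add_smul]
    ring
  rw [Derivation.leibniz, hχ.totalDt_eq, map_add, totalDt_coord, totalDt_coord, hsource,
    smul_eq_mul, smul_eq_mul]
  ring

theorem sum_totalDx_multiplierCurrent [NeZero n] (hK : ∀ i, totalDx i (K i) = χ) :
    ∑ i : Fin n, totalDx i (multiplierCurrent a c χ K i.succ) =
      lap χ * (V n + c • W n) - χ * lap (V n + c • W n) - a • χ := by
  simp only [multiplierCurrent, Fin.cons_succ, map_sub _ (_ - _), Derivation.map_smul, hK,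
    Finset.sum_sub_distrib, sum_totalDx_green]
  rw [Finset.sum_const, Finset.card_univ, Fintype.card_fin, ← Nat.cast_smul_eq_nsmul ℝ, smul_smul,
    mul_div_cancel₀ a (NeZero.ne (n : ℝ))]

theorem IsHeatMultiplier.multiplierCurrent_conserved [NeZero n] (hχ : IsHeatMultiplier c χ)
    (hK : ∀ i, totalDx i (K i) = χ) :
    totalDt (brusselator n a b c) (multiplierCurrent a c χ K 0) +
      ∑ i : Fin n, totalDx i (multiplierCurrent a c χ K i.succ) = 0 := by
  rw [sum_totalDx_multiplierCurrent hK, multiplierCurrent, Fin.cons_zero,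
    totalDt_mul_V_add_W hχ.uIndep]
  have hv := hχ.partialDeriv_t_add_lap
  have hw := hχ.partialDeriv_t_add_smul_lap
  rw [Algebra.smul_def] at hw ⊢
  rw [Algebra.smul_def]
  linear_combination V n * hv + W n * hw

theorem UIndep.eulerOp_mul_V_add_W (hχ : UIndep χ) (k : Fin 2) :
    eulerOp k (χ * (V n + W n)) = χ := by
  have hmem : χ * (V n + W n) ∈ ordLT n 2 1 :=
    mul_mem (hχ.mem_ordLT 1) (add_mem (coord_mem_ordLT_one 0) (coord_mem_ordLT_one 1))
  rw [eulerOp_apply, ← one_smul (DiffFun n 2) (jetDeriv k _),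
    jetAdjoint_smul_jetDeriv_of_mem_ordLT_one hmem, mul_one, Derivation.leibniz,
    hχ.partialDeriv_u_eq_zero, smul_zero, add_zero, smul_eq_mul]
  fin_cases k <;> simp

/-- The characteristic component `G e^{ct/(c-1)}` belonging to a function `G` of the space
variables. -/
def profileMultiplier {G : (Fin n → ℝ) → ℝ} (c : ℝ) (hG : ContDiff ℝ ∞ G) : DiffFun n m :=
  ofSpace hG * expTime n m (c / (c - 1))

section Profile

variable {G : (Fin n → ℝ) → ℝ} {H : Fin n → (Fin n → ℝ) → ℝ}

theorem profileMultiplier_apply (hG : ContDiff ℝ ∞ G) (p : Coord n m → ℝ) :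
    profileMultiplier c hG p = G (space p) * Real.exp (c * p .t / (c - 1)) := by
  rw [profileMultiplier, DiffFun.mul_apply, ofSpace_apply, expTime_apply, div_mul_eq_mul_div]

theorem totalDx_profileMultiplier (hG : ContDiff ℝ ∞ G) (i : Fin n) :
    totalDx i (profileMultiplier c hG : DiffFun n m) = profileMultiplier c (contDiff_pd hG i) := by
  simp [profileMultiplier, totalDx_expTime, totalDx_ofSpace, mul_comm]

theorem uIndep_profileMultiplier (hG : ContDiff ℝ ∞ G) :
    UIndep (profileMultiplier c hG : DiffFun n m) := fun k => by
  rw [profileMultiplier, Derivation.leibniz, uIndep_ofSpace hG k, uIndep_expTime _ k, smul_zero,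
    smul_zero, add_zero]

theorem partialDeriv_t_profileMultiplier (hG : ContDiff ℝ ∞ G) :
    partialDeriv .t (profileMultiplier c hG : DiffFun n m) =
      (c / (c - 1)) • profileMultiplier c hG := by
  simp [profileMultiplier, partialDeriv_ofSpace_of_ne, partialDeriv_t_expTime]

theorem isHeatMultiplier_iff (hc : c ≠ 1) {χ : DiffFun n m} : IsHeatMultiplier c χ ↔
    UIndep χ ∧ partialDeriv .t χ = (c / (c - 1)) • χ ∧ χ + (c - 1) • lap χ = 0 := by
  have hc' : c - 1 ≠ 0 := sub_ne_zero.2 hc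
  have hdiv : partialDeriv .t χ = (c / (c - 1)) • χ ↔ (c - 1) • partialDeriv .t χ = c • χ := by
    rw [div_eq_inv_mul, mul_smul, eq_inv_smul_iff₀ hc']
  rw [hdiv]
  refine ⟨fun ⟨hu, hv, hw⟩ => ⟨hu, ?_, ?_⟩, fun ⟨hu, ht, hlap⟩ => ⟨hu, ?_, ?_⟩⟩
  · linear_combination (norm := module) c • hv - hw
  · linear_combination (norm := module) hw - hv
  · refine (smul_right_inj hc').1 ?_
    linear_combination (norm := module) ht + hlap
  · refine (smul_eq_zero_iff_right hc').1 ?_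
    linear_combination (norm := module) ht + c • hlap

theorem IsProfile.isHeatMultiplier (hc : c ≠ 1) (hG : IsProfile c G) :
    IsHeatMultiplier c (profileMultiplier c hG.1 : DiffFun n m) := by
  refine (isHeatMultiplier_iff hc).2
    ⟨uIndep_profileMultiplier hG.1, partialDeriv_t_profileMultiplier hG.1, ?_⟩
  rw [profileMultiplier, lap_mul_of_totalDx_eq_zero _ fun i => totalDx_expTime i _,
    ← smul_mul_assoc, ← add_mul, hG.ofSpace_add_lap_eq_zero, zero_mul]

theorem IsHeatMultiplier.exists_profile (hc : c ≠ 1) {χ : DiffFun n m} (hχ : IsHeatMultiplier c χ) :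
    ∃ (G : (Fin n → ℝ) → ℝ) (hG : IsProfile c G), χ = profileMultiplier c hG.1 := by
  obtain ⟨hu, ht, hlap⟩ := (isHeatMultiplier_iff hc).1 hχ
  refine ⟨fun x => χ (point 0 x), ⟨contDiff_comp_point χ 0, fun x => ?_⟩, DiffFun.ext fun p => ?_⟩
  · simp only [pd_comp_point]
    have hlap' := congrArg (fun f : DiffFun n m => f (point 0 x)) hlap
    simpa only [lap_apply, hu.totalDx_eq, (hu.partialDeriv _).totalDx_eq, DiffFun.add_apply,
      DiffFun.smul_apply, DiffFun.sum_apply, DiffFun.zero_apply, smul_eq_mul] using hlap'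
  · exact eq_mul_exp_of_partialDeriv_t hu ht p

theorem IsAntiderivatives.totalDx_profileMultiplier (hG : ContDiff ℝ ∞ G)
    (hH : IsAntiderivatives G H) (i : Fin n) :
    totalDx i (profileMultiplier c (hH i).1 : DiffFun n m) = profileMultiplier c hG := by
  rw [Brusselator.totalDx_profileMultiplier]
  congr 2
  exact funext (hH i).2

/-- The components of `current` as differential functions. -/
def profileCurrent (a c : ℝ) (hG : ContDiff ℝ ∞ G) (hH : IsAntiderivatives G H) :
    Fin (n + 1) → DiffFun n 2 :=
  multiplierCurrent a c (profileMultiplier c hG) fun i => profileMultiplier c (hH i).1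

theorem coe_profileCurrent (hG : ContDiff ℝ ∞ G) (hH : IsAntiderivatives G H) :
    (fun k => ⇑(profileCurrent a c hG hH k)) = current a c G H := by
  funext k p
  cases k using Fin.cases with
  | zero => simp [profileCurrent, multiplierCurrent, current, profileMultiplier_apply]
  | succ i =>
    simp [profileCurrent, multiplierCurrent, current, profileMultiplier_apply,
      Brusselator.totalDx_profileMultiplier, totalDx_coord]
    ring

end Profile

end Current

section Classification

variable {a b c : ℝ} {G : (Fin n → ℝ) → ℝ} {H : Fin n → (Fin n → ℝ) → ℝ}

theorem eulerOp_profileCurrent (hG : ContDiff ℝ ∞ G) (hH : IsAntiderivatives G H) (k : Fin 2) :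
    eulerOp k (profileCurrent a c hG hH 0) = profileMultiplier c hG :=
  (uIndep_profileMultiplier hG).eulerOp_mul_V_add_W k

theorem characteristic_current (hG : ContDiff ℝ ∞ G) (hH : IsAntiderivatives G H) (k : Fin 2)
    (p : Coord n 2 → ℝ) :
    characteristic (current a c G H) k p = G (space p) * Real.exp (c * p .t / (c - 1)) := by
  rw [← coe_profileCurrent hG hH, characteristic_coe, eulerOp_profileCurrent,
    profileMultiplier_apply]

variable [NeZero n]

theorem profileCurrent_conserved (hc : c ≠ 1) (hG : IsProfile c G) (hH : IsAntiderivatives G H) :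
    totalDt (brusselator n a b c) (profileCurrent a c hG.1 hH 0) +
      ∑ i : Fin n, totalDx i (profileCurrent a c hG.1 hH i.succ) = 0 :=
  (hG.isHeatMultiplier hc).multiplierCurrent_conserved (hH.totalDx_profileMultiplier hG.1)

theorem isConservedCurrent_current (hc : c ≠ 1) (hG : IsProfile c G)
    (hH : IsAntiderivatives G H) :
    IsConservedCurrent (rhs n a b c) (current a c G H) := by
  rw [← coe_brusselator, ← coe_profileCurrent hG.1 hH]
  exact isConservedCurrent_coe_iff.2 (profileCurrent_conserved hc hG hH)

variable {J : Fin (n + 1) → DiffFun n 2}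

theorem exists_isHeatMultiplier (hc : c ≠ 0)
    (hJ : totalDt (brusselator n a b c) (J 0) + ∑ i : Fin n, totalDx i (J i.succ) = 0) :
    ∃ χ : DiffFun n 2, IsHeatMultiplier c χ ∧ ∀ k, eulerOp k (J 0) = χ := by
  have hχ := isCosymmetry_eulerOp hJ
  exact ⟨_, hχ.isHeatMultiplier hc, Fin.forall_fin_two.2 ⟨rfl, (hχ.zero_eq_one hc).symm⟩⟩

theorem currentEquiv_current (hc : c ≠ 1) (hG : IsProfile c G) (hH : IsAntiderivatives G H)
    (hJ : totalDt (brusselator n a b c) (J 0) + ∑ i : Fin n, totalDx i (J i.succ) = 0)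
    (hχ : ∀ k, eulerOp k (J 0) = profileMultiplier c hG.1) :
    CurrentEquiv (rhs n a b c) (fun k => ⇑(J k)) (current a c G H) := by
  rw [CurrentEquiv, ← coe_brusselator, ← coe_profileCurrent hG.1 hH]
  refine isTrivialCurrent_of_eulerOp_eq_zero (J := J - profileCurrent a c hG.1 hH) ?_ fun k => ?_
  · simp only [Pi.sub_apply, map_sub, Finset.sum_sub_distrib]
    linear_combination hJ - profileCurrent_conserved hc hG hH
  · rw [Pi.sub_apply, map_sub, hχ, eulerOp_profileCurrent, sub_self]

theorem IsConservedCurrent.exists_profile (hc : c ≠ 0) (hc1 : c ≠ 1)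
    {J : Fin (n + 1) → Fun n 2} (hJ : IsConservedCurrent (rhs n a b c) J) :
    ∃ G : (Fin n → ℝ) → ℝ, IsProfile c G ∧
      (∀ k p, characteristic J k p = G (space p) * Real.exp (c * p .t / (c - 1))) ∧
      ∀ H, IsAntiderivatives G H → CurrentEquiv (rhs n a b c) J (current a c G H) := by
  obtain ⟨J, rfl⟩ := hJ.exists_coe_eq
  rw [← coe_brusselator, isConservedCurrent_coe_iff] at hJ
  obtain ⟨χ, hχ, hJχ⟩ := exists_isHeatMultiplier hc hJ
  obtain ⟨G, hG, rfl⟩ := hχ.exists_profile hc1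
  refine ⟨G, hG, fun k p => ?_, fun H hH => currentEquiv_current hc1 hG hH hJ hJχ⟩
  rw [characteristic_coe, hJχ, profileMultiplier_apply]

theorem IsConservedCurrent.isTrivialCurrent_of_rhs_one {J : Fin (n + 1) → Fun n 2}
    (hJ : IsConservedCurrent (rhs n a b 1) J) : IsTrivialCurrent (rhs n a b 1) J := by
  obtain ⟨J, rfl⟩ := hJ.exists_coe_eq
  rw [← coe_brusselator] at hJ ⊢
  rw [isConservedCurrent_coe_iff] at hJ
  obtain ⟨χ, hχ, hJχ⟩ := exists_isHeatMultiplier one_ne_zero hJ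
  refine isTrivialCurrent_of_eulerOp_eq_zero hJ fun k => ?_
  rw [hJχ, ← hχ.partialDeriv_t_add_lap, ← hχ.partialDeriv_t_add_smul_lap, one_smul]

end Classification

end Brusselator

end

theorem mainTheorem7 (n : ℕ) (hn : 1 ≤ n) (a b c : ℝ) (hc : c ≠ 0) :
    (c ≠ 1 →
      (∀ G : (Fin n → ℝ) → ℝ, Brusselator.IsProfile c G →
        (∃ H : Fin n → (Fin n → ℝ) → ℝ, Brusselator.IsAntiderivatives G H) ∧
        ∀ H : Fin n → (Fin n → ℝ) → ℝ, Brusselator.IsAntiderivatives G H →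
          Brusselator.IsConservedCurrent (Brusselator.rhs n a b c)
            (Brusselator.current a c G H) ∧
          ∀ (k : Fin 2) (p : Brusselator.Coord n 2 → ℝ),
            Brusselator.characteristic (Brusselator.current a c G H) k p =
              G (Brusselator.space p) * Real.exp (c * p .t / (c - 1))) ∧
      (∀ J : Fin (n + 1) → Brusselator.Fun n 2,
        Brusselator.IsConservedCurrent (Brusselator.rhs n a b c) J →
        ∃ G : (Fin n → ℝ) → ℝ, Brusselator.IsProfile c G ∧
          (∀ (k : Fin 2) (p : Brusselator.Coord n 2 → ℝ),
            Brusselator.characteristic J k p =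
              G (Brusselator.space p) * Real.exp (c * p .t / (c - 1))) ∧
          ∀ H : Fin n → (Fin n → ℝ) → ℝ, Brusselator.IsAntiderivatives G H →
            Brusselator.CurrentEquiv (Brusselator.rhs n a b c) J
              (Brusselator.current a c G H))) ∧
    (c = 1 →
      ∀ J : Fin (n + 1) → Brusselator.Fun n 2,
        Brusselator.IsConservedCurrent (Brusselator.rhs n a b c) J →
        Brusselator.IsTrivialCurrent (Brusselator.rhs n a b c) J) := by
  have : NeZero n := ⟨Nat.one_le_iff_ne_zero.1 hn⟩
  refine ⟨fun hc1 => ⟨fun G hG => ?_, fun J hJ => hJ.exists_profile hc hc1⟩, ?_⟩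
  · exact ⟨Brusselator.exists_isAntiderivatives hG.1, fun H hH =>
      ⟨Brusselator.isConservedCurrent_current hc1 hG hH,
        Brusselator.characteristic_current hG.1 hH⟩⟩
  · rintro rfl J hJ
    exact hJ.isTrivialCurrent_of_rhs_one
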